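/- **Model.** Let $\mathcal G=(\mathcal V,\mathcal L)$ be a finite directed graph without self-loops. A link $\ell\in\mathcal L$ can carry at most $C_\ell\in\{0,1,2,\dots\}$ packets per time slot; let $C_{\min}=\min_{\ell\in\mathcal L}C_\ell$. Let $\overline{\mathcal L}=\mathcal L\cup\{(v,v):v\in\mathcal V\}$, where self-loops (waiting at a node) have infinite capacity, and let $\mathcal O(v),\mathcal I(v)\subseteq\overline{\mathcal L}$ be the links leaving and entering $v$. There are finitely many packet types $j=1,\dots,J$, with source $s_j$, destination $z_j$, deadline $d_j\in\{0,1,2,\dots\}$ and weight $w_j\ge 0$; let $d_{\max}=\max_j d_j$. In slot $t\in\{1,\dots,T\}$ a random number $a_j^t\in\{0,1,2,\dots\}$ of packets of type $j$ arrive; let $\lambda_j^t=\mathbb E[a_j^t]$ (possibly depending on $t$). A packet of type $j$ arriving in slot $t$ may be transmitted in slots $t,\dots,t+d_j$ and gives reward $w_j$ if it is at $z_j$ at the end of slot $t+d_j$. A route-schedule for type $j$ is a walk $k=[k_0\,k_1\cdots k_{d_j}]$ in $(\mathcal V,\overline{\mathcal L})$ with $k_0\in\mathcal O(s_j)$ and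 $k_{d_j}\in\mathcal I(z_j)$; $\mathcal K_j$ is the set of these. Let $L$ be the maximum, over all $j$ and $k\in\mathcal K_j$, of the number of $\tau$ with $k_\tau\in\mathcal L$ (the maximum number of link transmissions in a route). **Benchmark.** Given the arrivals, $\mathrm{RI}(T)$ is the integer program that maximizes $\sum_{t=1}^T\sum_j w_j\sum_{n=1}^{a_j^t}\sum_{k\in\mathcal K_j}y_{jk}^{nt}$ over $y_{jk}^{nt}\in\{0,1\}$ subject to $\sum_{k\in\mathcal K_j} y_{jk}^{nt}\le 1$ for every packet and, for all $\ell\in\mathcal L$ and $1\le t\le T+d_{\max}$, $\sum_{\tau}\sum_j\sum_{n=1}^{a_j^\tau}\sum_{k\in\mathcal K_j:\,k_{t-\tau}=\ell}y_{jk}^{n\tau}\le C_\ell$, where $\tau$ ranges over the arrival slots $W_t=\{\tau\in\{1,\dots,T\}:t-d_{\max}\le\tau\le t\}$. Its optimal value is $W^\star_{\mathrm{RI}(T)}$. **Linear program $F_{NS}$.** For $\varepsilon>0$, maximize $\sum_{t=1}^T\sum_j w_j\lambda_j^t\sum_{\ell\in\mathcal O(s_j)}f_{j\ell}^{0t}$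 over $f_{j\ell}^{\tau t}\ge 0$ ($\ell\in\overline{\mathcal L}$, $0\le\tau\le d_{\max}$, $1\le t\le T$) subject to, for all $j$ and $t\in\{1,\dots,T\}$: $\sum_{\ell\in\mathcal O(s_j)}f_{j\ell}^{0t}\le1$; $\sum_{\ell\in\mathcal I(v)}f_{j\ell}^{(\tau-1)t}=\sum_{\ell\in\mathcal O(v)}f_{j\ell}^{\tau t}$ for all $v\in\mathcal V$, $1\le\tau\le d_{\max}$; $f_{j\ell}^{0t}=0$ for $\ell\notin\mathcal O(s_j)$; $f_{j\ell}^{d_jt}=0$ for $\ell\notin\mathcal I(z_j)$; and $\sum_{\tau\in W_t}\sum_j\lambda_j^{\tau}f_{j\ell}^{(t-\tau)\tau}\le C_\ell/(1+\varepsilon)$ for all $\ell\in\mathcal L$ and $1\le t\le T+d_{\max}$. **Algorithm.** Fix any optimal solution $f$ of $F_{NS}$. In each slot, every unexpired packet in the network of type $j$, arrival slot $t$ and age $\tau$, located at node $v$, selects a link $\ell\in\mathcal O(v)$ at random, with probability $f_{j\ell}^{0t}$ if $\tau=0$ (no link, i.e. the packet is dropped, with the remaining probability), and with probability $f_{j\ell}^{\tau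 t}/\sum_{\ell'\in\mathcal O(v)}f_{j\ell'}^{\tau t}$ if $1\le\tau\le d_j$. The selections are independent of one another and of the arrivals. The packets are processed in an arbitrary order (which may differ from slot to slot and may be random); a packet moves over its selected link if that link still has available capacity in that slot, and is dropped otherwise. $W_{\mathrm{ALG}}$ is the total reward. **Dependency degree.** The traffic of type $j$ in a set $W$ of slots has dependency degree at most $D$ if, in law, its packets can be partitioned into finitely many mutually independent groups of at most $D$ packets each; that is, $(a_j^\tau)_{\tau\in W}$ has the law of $\sum_{i=1}^N (b_i^\tau)_{\tau\in W}$ with $N$ finite, independent random vectors $b_1,\dots,b_N$ in $\{0,1,2,\dots\}^W$, and $\sum_{\tau\in W}b_i^\tau\le D$ almost surely for each $i$. **Theorem.** Suppose that the arrival processes of different types are independent and that, for every $j$ and every $1\le t\le T+d_{\max}$, the traffic of type $j$ in the window $W_t$ has dependency degree at most $D$. Let $\varepsilon\in(0,1/2)$ and let $$C_{\min}\ \ge\ 2D\Big(\frac{1+\varepsilon}{\varepsilon}\Big)^2\log\frac L\varepsilon .$$ (No condition is needed if $L=0$.) Then, for every horizon $T$, the algorithm is a $(1-2\varepsilon)$-approximation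 to $\mathrm{RI}(T)$: $\ \mathbb E[W_{\mathrm{ALG}}]\ge(1-2\varepsilon)\,\mathbb E[W^\star_{\mathrm{RI}(T)}]$, both expectations being finite. -/

import Mathlib

open MeasureTheory ProbabilityTheory

/-- A capacitated communication network on the node set `V`, shared by the packet types `J`.
Links are ordered pairs of distinct nodes; staying at a node is modelled by the self-loops that
`extLinks` adds. -/
structure Network (V J : Type*) where
  links : Finset (V × V)
  irrefl : ∀ v, (v, v) ∉ links
  /-- number of packets that a link can carry per time slot (only used on `links`) -/
  cap : V × V → ℕ
  src : J → V
  dst : J → V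
  deadline : J → ℕ
  weight : J → ℝ
  weight_nonneg : ∀ j, 0 ≤ weight j

/-- A packet `(j, s, n)`: the packet number `n` (counted from `0`) among the packets of type `j`
arriving at time `s`. -/
abbrev Packet (J : Type*) := J × ℕ × ℕ

/-- The packets that arrive during `1, …, T`. -/
def arrivedPackets {J : Type*} [Fintype J] [DecidableEq J] (T : ℕ) (A : J → ℕ → ℕ) :
    Finset (Packet J) :=
  (Finset.univ ×ˢ Finset.Icc 1 T).biUnion fun q =>
    (Finset.range (A q.1 q.2)).image fun n => (q.1, q.2, n)

/-- What is selected for a packet in a time slot: a link to be taken, or no link (drop). -/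
inductive Choice (V : Type*) where
  | drop : Choice V
  | take (l : V × V) : Choice V

instance (V : Type*) : MeasurableSpace (Choice V) := ⊤

namespace Network

section

variable {V J : Type*} [Fintype V] [DecidableEq V] [Fintype J] [DecidableEq J] (N : Network V J)

/-- The links together with all self-loops. -/
def extLinks : Finset (V × V) := N.links ∪ Finset.univ.diag

/-- Outgoing links of a node, self-loop included. -/
def outLinks (v : V) : Finset (V × V) := N.extLinks.filter (fun l => l.1 = v)

/-- Incoming links of a node, self-loop included. -/
def inLinks (v : V) : Finset (V × V) := N.extLinks.filter (fun l => l.2 = v)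

/-- Capacity on the extended link set: self-loops have infinite capacity. -/
def extCap (l : V × V) : ℕ∞ := if l.1 = l.2 then ⊤ else (N.cap l : ℕ∞)

/-- The maximum deadline. -/
def dmax : ℕ := Finset.univ.sup N.deadline

/-- The arrival times `(t - dmax)⁺, …, t ∧ T` (within `1, …, T`) of the packets that may be in the
network in slot `t`. -/
def window (T t : ℕ) : Finset ℕ := Finset.Icc (max 1 (t - N.dmax)) (min t T)

/-- Relative route-schedules for type `j`: directed walks `k₀ k₁ … k_d` (`d` the deadline) in the
graph with self-loops, from the source to the destination. -/
def IsRoute (j : J) (k : Fin (N.deadline j + 1) → V × V) : Prop :=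
  (∀ τ, k τ ∈ N.extLinks) ∧
  (∀ τ : Fin (N.deadline j), (k τ.castSucc).2 = (k τ.succ).1) ∧
  k 0 ∈ N.outLinks (N.src j) ∧
  k (Fin.last _) ∈ N.inLinks (N.dst j)

open Classical in
/-- The finite set of all route-schedules for type `j`. -/
noncomputable def routes (j : J) : Finset (Fin (N.deadline j + 1) → V × V) :=
  Finset.univ.filter (N.IsRoute j)

/-- The route-schedule `k` uses the link `l` at age `τ`; false for ages beyond the deadline. -/
def UsesAt {j : J} (k : Fin (N.deadline j + 1) → V × V) (τ : ℕ) (l : V × V) : Prop :=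
  ∃ h : τ < N.deadline j + 1, k ⟨τ, h⟩ = l

/-- The maximum number of (genuine) link transmissions in a route-schedule of any packet type. -/
noncomputable def maxRouteLength : ℕ :=
  Finset.univ.sup fun j : J => (N.routes j).sup fun k =>
    (Finset.univ.filter fun τ => k τ ∈ N.links).card

/-! ### The integer program for a given arrival sequence -/

open Classical in
/-- `y j t n k` decides whether the `n`-th packet of type `j` arriving at `t` is scheduled on
the route-schedule `k`, when `A j t` packets of type `j` arrive at `t`. -/
structure RIFeasible (T : ℕ) (A : J → ℕ → ℕ)
    (y : (j : J) → ℕ → ℕ → (Fin (N.deadline j + 1) → V × V) → ℕ) : Prop where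
  one_choice : ∀ t ∈ Finset.Icc 1 T, ∀ j, ∀ n ∈ Finset.range (A j t),
    ∑ k ∈ N.routes j, y j t n k ≤ 1
  capacity : ∀ l ∈ N.links, ∀ t ∈ Finset.Icc 1 (T + N.dmax),
    ∑ s ∈ N.window T t, ∑ j, ∑ n ∈ Finset.range (A j s),
      ∑ k ∈ (N.routes j).filter (fun k => N.UsesAt k (t - s) l), y j s n k ≤ N.cap l
  binary : ∀ j, ∀ t ∈ Finset.Icc 1 T, ∀ n ∈ Finset.range (A j t), ∀ k ∈ N.routes j,
    y j t n k = 0 ∨ y j t n k = 1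

/-- Weighted number of scheduled packets. -/
noncomputable def riObjective (T : ℕ) (A : J → ℕ → ℕ)
    (y : (j : J) → ℕ → ℕ → (Fin (N.deadline j + 1) → V × V) → ℕ) : ℝ :=
  ∑ t ∈ Finset.Icc 1 T, ∑ j, N.weight j *
    ∑ n ∈ Finset.range (A j t), ∑ k ∈ N.routes j, (y j t n k : ℝ)

/-- The optimal value of the integer program. The set of values is nonempty (schedule nothing) and
bounded (by the total weight of the arrivals), so this is a genuine supremum. -/
noncomputable def riValue (T : ℕ) (A : J → ℕ → ℕ) : ℝ :=
  sSup {x | ∃ y, N.RIFeasible T A y ∧ N.riObjective T A y = x}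

/-! ### The flow-based linear program with time-dependent forwarding variables -/

/-- Feasibility for the linear program with arrival rates `lam j t`. The variable `f j l τ t` is the
fraction of the packets of type `j` arriving at `t` to be sent over `l` at age `τ`. -/
structure FNSFeasible (T : ℕ) (lam : J → ℕ → ℝ) (ε : ℝ) (f : J → V × V → ℕ → ℕ → ℝ) :
    Prop where
  one_choice : ∀ j, ∀ t ∈ Finset.Icc 1 T, ∑ l ∈ N.outLinks (N.src j), f j l 0 t ≤ 1
  conservation : ∀ v, ∀ τ ∈ Finset.Icc 1 N.dmax, ∀ j, ∀ t ∈ Finset.Icc 1 T,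
    ∑ l ∈ N.inLinks v, f j l (τ - 1) t = ∑ l ∈ N.outLinks v, f j l τ t
  source : ∀ j, ∀ t ∈ Finset.Icc 1 T, ∀ l ∈ N.extLinks, l ∉ N.outLinks (N.src j) →
    f j l 0 t = 0
  destination : ∀ j, ∀ t ∈ Finset.Icc 1 T, ∀ l ∈ N.extLinks, l ∉ N.inLinks (N.dst j) →
    f j l (N.deadline j) t = 0
  capacity : ∀ l ∈ N.links, ∀ t ∈ Finset.Icc 1 (T + N.dmax),
    ∑ s ∈ N.window T t, ∑ j, lam j s * f j l (t - s) s ≤ (N.cap l : ℝ) / (1 + ε)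
  nonneg : ∀ j, ∀ l ∈ N.extLinks, ∀ τ ≤ N.dmax, ∀ t ∈ Finset.Icc 1 T, 0 ≤ f j l τ t

/-- Expected weighted number of packets forwarded out of their sources. -/
noncomputable def fnsObjective (T : ℕ) (lam : J → ℕ → ℝ) (f : J → V × V → ℕ → ℕ → ℝ) : ℝ :=
  ∑ t ∈ Finset.Icc 1 T, ∑ j, N.weight j * lam j t * ∑ l ∈ N.outLinks (N.src j), f j l 0 t

/-- `f` is an optimal solution of the linear program. -/
def IsFNSOptimal (T : ℕ) (lam : J → ℕ → ℝ) (ε : ℝ) (f : J → V × V → ℕ → ℕ → ℝ) : Prop :=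
  N.FNSFeasible T lam ε f ∧
    ∀ g, N.FNSFeasible T lam ε g → N.fnsObjective T lam g ≤ N.fnsObjective T lam f

/-! ### Probabilistic forwarding -/

/-- Probability with which a packet of type `j` that arrived at time `t`, and is at node `v` at age
`τ`, selects the link `l`. With the remaining probability no link is selected. -/
noncomputable def forwardProb (f : J → V × V → ℕ → ℕ → ℝ) (j : J) (t τ : ℕ) (v : V)
    (l : V × V) : ℝ :=
  if l ∈ N.outLinks v then
    if τ = 0 then f j l 0 t else f j l τ t / ∑ l' ∈ N.outLinks v, f j l' τ t
  else 0

/-- The selection of packet `p` in slot `t`, given the packet locations at the beginning of that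
slot (`none`: not in the network); `c p τ v` is what `p` selects when at node `v` at age `τ`.
Expired packets select nothing. -/
def selected (c : Packet J → ℕ → V → Choice V) (t : ℕ) (loc : Packet J → Option V)
    (p : Packet J) : Choice V :=
  match loc p with
  | none => Choice.drop
  | some v => if t ≤ p.2.1 + N.deadline p.1 then c p (t - p.2.1) v else Choice.drop

open Classical in
/-- Number of arrived packets that select the link `l` in slot `t` and are processed before `p`;
packets are processed in increasing order of `r`. -/
noncomputable def numBefore (T : ℕ) (A : J → ℕ → ℕ) (c : Packet J → ℕ → V → Choice V)
    (r : Packet J → ℕ) (t : ℕ) (loc : Packet J → Option V) (p : Packet J) (l : V × V) : ℕ :=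
  ((arrivedPackets T A).filter fun q => N.selected c t loc q = Choice.take l ∧ r q < r p).card

/-- The location of `p` after slot `t`: it has moved along the selected link if capacity was
still available there when `p` was processed, and is dropped otherwise. -/
noncomputable def step (T : ℕ) (A : J → ℕ → ℕ) (c : Packet J → ℕ → V → Choice V)
    (r : Packet J → ℕ) (t : ℕ) (loc : Packet J → Option V) (p : Packet J) : Option V :=
  match N.selected c t loc p with
  | Choice.drop => none
  | Choice.take l => if (N.numBefore T A c r t loc p l : ℕ∞) < N.extCap l then some l.2 else none

/-- The locations of the packets at the beginning of each slot (`none`: not yet arrived, or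
dropped, or expired earlier), when slot `t` processes packets in increasing order of `r t`. -/
noncomputable def location (T : ℕ) (A : J → ℕ → ℕ) (c : Packet J → ℕ → V → Choice V)
    (r : ℕ → Packet J → ℕ) : ℕ → Packet J → Option V
  | 0 => fun _ => none
  | t + 1 => fun p =>
      if p ∈ arrivedPackets T A ∧ p.2.1 = t + 1 then some (N.src p.1)
      else N.step T A c (r t) t (location T A c r t) p

/-- Total weight of the packets that are at their destination at the end of the slot
in which they expire. -/
noncomputable def algReward (T : ℕ) (A : J → ℕ → ℕ) (c : Packet J → ℕ → V → Choice V)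
    (r : ℕ → Packet J → ℕ) : ℝ :=
  ∑ p ∈ arrivedPackets T A,
    if N.location T A c r (p.2.1 + N.deadline p.1 + 1) p = some (N.dst p.1)
    then N.weight p.1 else 0

/-- The random selections `c p τ v` of probabilistic forwarding: mutually independent, independent
of the arrivals, and distributed according to the forwarding variables `f`. -/
structure IsForwardingRandomness {Ω : Type*} [MeasurableSpace Ω] (μ : Measure Ω) (T : ℕ)
    (a : J → ℕ → Ω → ℕ) (f : J → V × V → ℕ → ℕ → ℝ)
    (c : Packet J → ℕ → V → Ω → Choice V) : Prop where
  measurable : ∀ p τ v, Measurable (c p τ v)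
  law : ∀ j, ∀ s ∈ Finset.Icc 1 T, ∀ n, ∀ τ ≤ N.deadline j, ∀ v l,
    μ.real {ω | c (j, s, n) τ v ω = Choice.take l} = N.forwardProb f j s τ v l
  indep : iIndepFun (fun (i : Packet J × ℕ × V) ω => c i.1 i.2.1 i.2.2 ω) μ
  indep_arrivals : IndepFun (fun ω j t => a j t ω)
    (fun ω (i : Packet J × ℕ × V) => c i.1 i.2.1 i.2.2 ω) μ

end

end Network

/-! ### Dependency degree -/

/-- The law `ν` of the numbers of arrivals in the time slots `ι` is that of a superposition of
finitely many independent groups of arrivals, where each group comprises at most `D` packets in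
total. The vector `b i` holds the arrivals of the group `i` per slot. -/
def IsDecomposable {ι : Type*} [Fintype ι] (ν : Measure (ι → ℕ)) (D : ℕ) : Prop :=
  ∃ (n : ℕ) (ρ : Fin n → Measure (ι → ℕ)),
    (∀ i, IsProbabilityMeasure (ρ i)) ∧
    (∀ i, ∀ᵐ b ∂(ρ i), ∑ s, b s ≤ D) ∧
    ν = (Measure.pi ρ).map (fun b s => ∑ i, b i s)

/-- The smallest possible bound on the group sizes (infinite if there is none). -/
noncomputable def dependencyDegree {ι : Type*} [Fintype ι] (ν : Measure (ι → ℕ)) : ℕ∞ :=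
  ⨅ (D : ℕ) (_ : IsDecomposable ν D), (D : ℕ∞)

/-- A random reward `alg` is a `γ`-approximation of the random optimum `opt`. -/
def IsApproximation {Ω : Type*} [MeasurableSpace Ω] (μ : Measure Ω) (γ : ℝ)
    (alg opt : Ω → ℝ) : Prop :=
  Integrable alg μ ∧ Integrable opt μ ∧ γ * ∫ ω, opt ω ∂μ ≤ ∫ ω, alg ω ∂μ

/-! The benchmark and the algorithm are both compared with the optimal value `F` of the linear
program. Averaging near-optimal schedules over the arrivals and dividing by `1 + ε` gives a feasible
flow, so the expected integer optimum is at most `(1 + ε) F` (`exists_feasible_of_schedules`,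
`integral_riValue_le`). Since `(1 - 2ε)(1 + ε) ≤ 1 - ε - ε²`, it suffices that the algorithm earns
`(1 - (1 + ε) ε) F` (`integral_algReward_ge`).

Let every packet follow its selections with capacities ignored. These walks are independent of each
other and of the arrivals, and each selects a link at a given age with probability exactly `f`
(`prob_picks`), so it reaches its destination with probability equal to the mass that leaves the
source. The packets that really compete for a link are among those whose walks select it. Hence,
whatever the processing order, a packet is dropped against its walk only at a link whose walk load
exceeds the capacity (`location_eq_walk`), and the loss is at most the number of pairs of a packet
and an overloaded link on its walk.

For one such pair and fixed arrivals, Markov's inequality is applied to `(1 + u) ^ load` on the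
event that the packet itself selects the link (`prob_mem_and_lt_card_le`). The bound is then
averaged over the arrivals. The generating function factorizes over independent groups; a group of
at most `D` packets is dominated by a variable on `{0, D}` with the same mean
(`prod_one_add_pow_le`), while the group of the marked packet costs an extra `(1 + u) ^ (D - 1)`,
because its mates may be fully correlated with it (`prod_one_add_pow_le_of_pos`). With `(1 + u) ^ D
= 1 + ε` and mean load at most `C / (1 + ε)`, the fraction lost at a link is at most `(1 + ε) exp
(-(C / D) (log (1 + ε) - ε / (1 + ε)))`, which the capacity hypothesis makes at most `(1 + ε) ε / L`
(`exp_div_pow_le`). A walk that leaves its source almost surely completes a route, hence uses at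
most `L` links (`sum_links_le`); the total loss is therefore at most the fraction `(1 + ε) ε` of
`F`. -/

set_option linter.unusedSectionVars false

/-! ### Walks that ignore capacities -/

/-- The node reached by a choice, `none` if the packet is dropped. -/
def Choice.target {V : Type*} : Choice V → Option V
  | Choice.drop => none
  | Choice.take l => some l.2

/-- The node occupied at each age by a packet that follows its choices regardless of capacities. -/
def walk {V : Type*} (c : ℕ → V → Choice V) (v₀ : V) : ℕ → Option V
  | 0 => some v₀
  | τ + 1 => (walk c v₀ τ).bind fun v => (c τ v).target

/-- The capacity-ignoring walk selects the link `l` at age `τ`. -/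
def Picks {V : Type*} (c : ℕ → V → Choice V) (v₀ : V) (τ : ℕ) (l : V × V) : Prop :=
  ∃ v, walk c v₀ τ = some v ∧ c τ v = Choice.take l

theorem Picks.walk_succ {V : Type*} {c : ℕ → V → Choice V} {v₀ : V} {τ : ℕ} {l : V × V}
    (h : Picks c v₀ τ l) : walk c v₀ (τ + 1) = some l.2 := by
  obtain ⟨v, hv, hc⟩ := h
  simp [walk, hv, hc, Choice.target]

theorem walk_succ_eq_some {V : Type*} {c : ℕ → V → Choice V} {v₀ : V} {τ : ℕ} {w : V} :
    walk c v₀ (τ + 1) = some w ↔ ∃ l : V × V, l.2 = w ∧ Picks c v₀ τ l := by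
  constructor
  · intro h
    rw [walk, Option.bind_eq_some_iff] at h
    obtain ⟨v, hv, hc⟩ := h
    cases hcv : c τ v with
    | drop => simp [hcv, Choice.target] at hc
    | take l =>
      rw [hcv] at hc
      exact ⟨l, by simpa [Choice.target] using hc, v, hv, hcv⟩
  · rintro ⟨l, rfl, h⟩
    exact h.walk_succ

theorem Picks.unique {V : Type*} {c : ℕ → V → Choice V} {v₀ : V} {τ : ℕ} {l l' : V × V}
    (h : Picks c v₀ τ l) (h' : Picks c v₀ τ l') : l = l' := by
  obtain ⟨v, hv, hc⟩ := h
  obtain ⟨v', hv', hc'⟩ := h'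
  rw [hv] at hv'
  cases hv'
  rw [hc] at hc'
  cases hc'
  rfl

/-! ### The set of arrived packets -/

theorem mem_arrivedPackets {J : Type*} [Fintype J] [DecidableEq J] {T : ℕ} {A : J → ℕ → ℕ}
    {p : Packet J} :
    p ∈ arrivedPackets T A ↔ p.2.1 ∈ Finset.Icc 1 T ∧ p.2.2 < A p.1 p.2.1 := by
  obtain ⟨j, s, n⟩ := p
  simp only [arrivedPackets, Finset.mem_biUnion, Finset.mem_product, Finset.mem_univ, true_and,
    Finset.mem_image, Finset.mem_range, Prod.exists]
  constructor
  · rintro ⟨j', s', hs, n', hn, h⟩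
    cases h
    exact ⟨hs, hn⟩
  · rintro ⟨hs, hn⟩
    exact ⟨j, s, hs, n, hn, rfl⟩

theorem sum_arrivedPackets {J M : Type*} [Fintype J] [DecidableEq J] [AddCommMonoid M] (T : ℕ)
    (A : J → ℕ → ℕ) (g : Packet J → M) :
    ∑ p ∈ arrivedPackets T A, g p
      = ∑ j, ∑ s ∈ Finset.Icc 1 T, ∑ n ∈ Finset.range (A j s), g (j, s, n) := by
  rw [← Finset.sum_product', arrivedPackets, Finset.sum_biUnion]
  · refine Finset.sum_congr rfl fun q _ => ?_
    rw [Finset.sum_image]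
    intro n _ n' _ h
    simpa using h
  · intro q _ q' _ hq
    simp only [Function.onFun, Finset.disjoint_left, Finset.mem_image]
    rintro p ⟨n, _, rfl⟩ ⟨n', _, h⟩
    apply hq
    simp only [Prod.mk.injEq] at h
    exact Prod.ext h.1.symm h.2.1.symm

theorem prod_arrivedPackets {J M : Type*} [Fintype J] [DecidableEq J] [CommMonoid M] (T : ℕ)
    (A : J → ℕ → ℕ) (g : Packet J → M) :
    ∏ p ∈ arrivedPackets T A, g p
      = ∏ j, ∏ s ∈ Finset.Icc 1 T, ∏ n ∈ Finset.range (A j s), g (j, s, n) :=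
  sum_arrivedPackets (M := Additive M) T A g

theorem arrivedPackets_congr {J : Type*} [Fintype J] [DecidableEq J] {T : ℕ} {A A' : J → ℕ → ℕ}
    (h : ∀ j, ∀ s ∈ Finset.Icc 1 T, A j s = A' j s) : arrivedPackets T A = arrivedPackets T A' := by
  ext p
  rw [mem_arrivedPackets, mem_arrivedPackets]
  exact and_congr_right fun hs => by rw [h _ _ hs]

/-! ### Pathwise comparison of the algorithm with the walks -/

namespace Network

variable {V J : Type*} [Fintype V] [DecidableEq V] [Fintype J] [DecidableEq J] (N : Network V J)

theorem deadline_le_dmax (j : J) : N.deadline j ≤ N.dmax :=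
  Finset.le_sup (f := N.deadline) (Finset.mem_univ j)

theorem selected_eq_take {c : Packet J → ℕ → V → Choice V} {t : ℕ} {loc : Packet J → Option V}
    {p : Packet J} {l : V × V} :
    N.selected c t loc p = Choice.take l ↔
      ∃ v, loc p = some v ∧ t ≤ p.2.1 + N.deadline p.1 ∧ c p (t - p.2.1) v = Choice.take l := by
  unfold selected
  cases h : loc p with
  | none => simp
  | some v =>
    by_cases ht : t ≤ p.2.1 + N.deadline p.1 <;> simp [ht]

variable (T : ℕ) (A : J → ℕ → ℕ) (c : Packet J → ℕ → V → Choice V) (r : ℕ → Packet J → ℕ)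

theorem location_succ (t : ℕ) (p : Packet J) :
    N.location T A c r (t + 1) p = if p ∈ arrivedPackets T A ∧ p.2.1 = t + 1
      then some (N.src p.1) else N.step T A c (r t) t (N.location T A c r t) p := rfl

theorem location_congr {T : ℕ} {A A' : J → ℕ → ℕ}
    (h : arrivedPackets T A = arrivedPackets T A') (t : ℕ) :
    N.location T A c r t = N.location T A' c r t := by
  induction t with
  | zero => rfl
  | succ t ih =>
    have hstep : ∀ r t loc p, N.step T A c r t loc p = N.step T A' c r t loc p := fun r t loc p => by
      have hnb : N.numBefore T A = N.numBefore T A' := by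
        funext c r t loc p l
        rw [numBefore, numBefore, h]
      rw [step, step, hnb]
    funext p
    rw [location_succ, location_succ, ih, hstep]
    simp only [h]

theorem algReward_congr {T : ℕ} {A A' : J → ℕ → ℕ}
    (h : arrivedPackets T A = arrivedPackets T A') :
    N.algReward T A c r = N.algReward T A' c r := by
  simp only [algReward, h, N.location_congr c r h]

theorem location_succ_eq_some {t : ℕ} {p : Packet J} {w : V}
    (hp : ¬ (p ∈ arrivedPackets T A ∧ p.2.1 = t + 1)) :
    N.location T A c r (t + 1) p = some w ↔
      ∃ l : V × V, l.2 = w ∧ N.selected c t (N.location T A c r t) p = Choice.take l ∧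
        (N.numBefore T A c (r t) t (N.location T A c r t) p l : ℕ∞) < N.extCap l := by
  rw [location_succ, if_neg hp, step]
  cases hs : N.selected c t (N.location T A c r t) p with
  | drop => simp
  | take l =>
    by_cases h : (N.numBefore T A c (r t) t (N.location T A c r t) p l : ℕ∞) < N.extCap l
    · simp only [h, if_true, Option.some.injEq, Choice.take.injEq]
      constructor
      · rintro rfl
        exact ⟨l, rfl, rfl, h⟩
      · rintro ⟨l', rfl, rfl, _⟩
        rfl
    · simp only [h, if_false, reduceCtorEq, false_iff, Choice.take.injEq, not_exists, not_and]
      rintro l' _ rfl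
      exact h

/-- Capacity-limited packets that are still in the network are where the walk is. -/
theorem location_eq_some {t : ℕ} {p : Packet J} {v : V}
    (h : N.location T A c r t p = some v) :
    p ∈ arrivedPackets T A ∧ p.2.1 ≤ t ∧ t ≤ p.2.1 + N.deadline p.1 + 1 ∧
      walk (c p) (N.src p.1) (t - p.2.1) = some v := by
  induction t generalizing v with
  | zero => simp [location] at h
  | succ t ih =>
    by_cases hp : p ∈ arrivedPackets T A ∧ p.2.1 = t + 1
    · rw [location_succ, if_pos hp] at h
      refine ⟨hp.1, hp.2.le, by omega, ?_⟩
      rw [hp.2, Nat.sub_self]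
      exact h
    · rw [N.location_succ_eq_some T A c r hp] at h
      obtain ⟨l, rfl, hs, _⟩ := h
      obtain ⟨v', hv', ht, hc⟩ := N.selected_eq_take.1 hs
      obtain ⟨h1, h2, h3, h4⟩ := ih hv'
      refine ⟨h1, by omega, by omega, ?_⟩
      rw [Nat.sub_add_comm h2]
      exact Picks.walk_succ ⟨v', h4, hc⟩

/-- Whether the packet `p` selects `l` in slot `t` if capacities are ignored. -/
def PicksInSlot (t : ℕ) (l : V × V) (p : Packet J) : Prop :=
  p.2.1 ≤ t ∧ t ≤ p.2.1 + N.deadline p.1 ∧ Picks (c p) (N.src p.1) (t - p.2.1) l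

open Classical in
/-- The number of packets that select `l` in slot `t` if capacities are ignored. -/
noncomputable def load (t : ℕ) (l : V × V) : ℕ :=
  ((arrivedPackets T A).filter (N.PicksInSlot c t l)).card

/-- A packet still in the network sits where its walk is, so every real competitor for `l` also
selects `l` in its walk. The strict inequality turns `load ≤ cap` into free capacity for `p`. -/
theorem numBefore_lt_load {t : ℕ} {p : Packet J} {l : V × V} (hp : p ∈ arrivedPackets T A)
    (hs : N.selected c t (N.location T A c r t) p = Choice.take l) :
    N.numBefore T A c (r t) t (N.location T A c r t) p l < N.load T A c t l := by
  classical
  have key : ∀ q, N.selected c t (N.location T A c r t) q = Choice.take l →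
      q.2.1 ≤ t ∧ t ≤ q.2.1 + N.deadline q.1 ∧ Picks (c q) (N.src q.1) (t - q.2.1) l := by
    intro q hq
    obtain ⟨v, hv, ht, hc⟩ := N.selected_eq_take.1 hq
    obtain ⟨_, h2, _, h4⟩ := N.location_eq_some T A c r hv
    exact ⟨h2, ht, v, h4, hc⟩
  apply Finset.card_lt_card
  rw [Finset.ssubset_iff_of_subset]
  -- `p` contributes to the load but is not processed before itself.
  · exact ⟨p, by simp only [Finset.mem_filter]; exact ⟨hp, key p hs⟩, by simp⟩
  · intro q hq
    simp only [Finset.mem_filter] at hq ⊢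
    exact ⟨hq.1, key q hq.2.1⟩

/-- A packet that meets no overloaded link follows the walk. -/
theorem location_eq_walk {p : Packet J} (hp : p ∈ arrivedPackets T A)
    (h : ∀ τ ≤ N.deadline p.1, ∀ l : V × V, l.1 ≠ l.2 → Picks (c p) (N.src p.1) τ l →
      N.load T A c (p.2.1 + τ) l ≤ N.cap l) :
    ∀ τ ≤ N.deadline p.1 + 1, ∀ v, walk (c p) (N.src p.1) τ = some v →
      N.location T A c r (p.2.1 + τ) p = some v := by
  intro τ
  induction τ with
  | zero =>
    intro _ v hv
    -- Packets are placed at their source only in slots of the form `t + 1`; slot `0` is empty.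
    have hs : 1 ≤ p.2.1 := (Finset.mem_Icc.1 (mem_arrivedPackets.1 hp).1).1
    obtain ⟨s, hs⟩ := Nat.exists_eq_add_of_le' hs
    rw [add_zero, hs, location_succ, if_pos ⟨hp, hs⟩]
    exact hv
  | succ τ ih =>
    intro hτ w hw
    rw [← add_assoc, N.location_succ_eq_some T A c r (by omega)]
    obtain ⟨l, rfl, v, hv, hc⟩ := walk_succ_eq_some.1 hw
    have hsel : N.selected c (p.2.1 + τ) (N.location T A c r (p.2.1 + τ)) p = Choice.take l := by
      rw [N.selected_eq_take]
      exact ⟨v, ih (by omega) v hv, by omega, by rwa [Nat.add_sub_cancel_left]⟩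
    refine ⟨l, rfl, hsel, ?_⟩
    unfold extCap
    split_ifs with hl
    · exact WithTop.coe_lt_top _
    · have := N.numBefore_lt_load T A c r hp hsel
      have := h τ (by omega) l hl ⟨v, hv, hc⟩
      exact_mod_cast (by omega)

open Classical in
/-- The reward from a packet is at least that of its walk, up to the overloaded links it meets. -/
theorem indicator_location_ge {p : Packet J} (hp : p ∈ arrivedPackets T A) :
    (if walk (c p) (N.src p.1) (N.deadline p.1 + 1) = some (N.dst p.1) then (1 : ℝ) else 0)
      - ∑ τ ∈ Finset.range (N.deadline p.1 + 1), ∑ l : V × V with l.1 ≠ l.2,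
        (if Picks (c p) (N.src p.1) τ l ∧ N.cap l < N.load T A c (p.2.1 + τ) l then (1 : ℝ) else 0)
    ≤ if N.location T A c r (p.2.1 + N.deadline p.1 + 1) p = some (N.dst p.1) then 1 else 0 := by
  have hnn : ∀ τ ∈ Finset.range (N.deadline p.1 + 1), 0 ≤ ∑ l : V × V with l.1 ≠ l.2,
        (if Picks (c p) (N.src p.1) τ l ∧ N.cap l < N.load T A c (p.2.1 + τ) l
          then (1 : ℝ) else 0) :=
    fun τ _ => Finset.sum_nonneg fun l _ => by positivity
  by_cases h : ∀ τ ≤ N.deadline p.1, ∀ l : V × V, l.1 ≠ l.2 → Picks (c p) (N.src p.1) τ l →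
      N.load T A c (p.2.1 + τ) l ≤ N.cap l
  · refine (sub_le_self _ (Finset.sum_nonneg hnn)).trans ?_
    by_cases hw : walk (c p) (N.src p.1) (N.deadline p.1 + 1) = some (N.dst p.1)
    · have := N.location_eq_walk T A c r hp h _ le_rfl _ hw
      rw [← add_assoc] at this
      simp [hw, this]
    · simp only [hw, if_false]
      positivity
  · push Not at h
    obtain ⟨τ, hτ, l, hl, hp1, hp2⟩ := h
    -- One overloaded link on the walk already makes the left-hand side nonpositive. The sum runs
    -- over all pairs of distinct nodes because selections outside the link set are excluded only
    -- almost surely.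
    have h1 : (1 : ℝ) ≤ ∑ τ ∈ Finset.range (N.deadline p.1 + 1), ∑ l : V × V with l.1 ≠ l.2,
        (if Picks (c p) (N.src p.1) τ l ∧ N.cap l < N.load T A c (p.2.1 + τ) l
          then (1 : ℝ) else 0) := by
      refine le_trans ?_ (Finset.single_le_sum hnn (Finset.mem_range.2 (Nat.lt_succ_of_le hτ)))
      refine le_trans ?_ (Finset.single_le_sum (fun l _ => by positivity)
        (Finset.mem_filter.2 ⟨Finset.mem_univ l, hl⟩))
      simp [hp1, hp2]
    have h2 : (if walk (c p) (N.src p.1) (N.deadline p.1 + 1) = some (N.dst p.1) then (1 : ℝ)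
      else 0) ≤ 1 := by split_ifs <;> norm_num
    refine (sub_nonpos.2 (h2.trans h1)).trans ?_
    positivity

end Network

/-! ### Measurability and law of a random walk -/

theorem Choice.measurableSet_setOf_eq {V Ω : Type*} {m : MeasurableSpace Ω} {c : Ω → Choice V}
    (hc : Measurable[m] c) (P : Choice V → Prop) : MeasurableSet[m] {ω | P (c ω)} :=
  hc (t := {x | P x}) trivial

theorem setOf_walk_succ {V Ω : Type*} [Fintype V] (c : ℕ → V → Ω → Choice V) (v₀ : V) (τ : ℕ)
    (w : V) : {ω | walk (fun τ v => c τ v ω) v₀ (τ + 1) = some w}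
      = ⋃ v : V, {ω | walk (fun τ v => c τ v ω) v₀ τ = some v} ∩
          {ω | (c τ v ω).target = some w} := by
  ext ω
  simp [walk, Option.bind_eq_some_iff]

theorem setOf_picks {V Ω : Type*} [Fintype V] (c : ℕ → V → Ω → Choice V) (v₀ : V) (τ : ℕ)
    (l : V × V) : {ω | Picks (fun τ v => c τ v ω) v₀ τ l}
      = ⋃ v : V, {ω | walk (fun τ v => c τ v ω) v₀ τ = some v} ∩ {ω | c τ v ω = Choice.take l} := by
  ext ω
  simp [Picks]

theorem measurableSet_walk {V Ω : Type*} [Fintype V] {m : MeasurableSpace Ω}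
    {c : ℕ → V → Ω → Choice V} (v₀ : V) {τ : ℕ} (hc : ∀ τ' < τ, ∀ v, Measurable[m] (c τ' v))
    (v : V) : MeasurableSet[m] {ω | walk (fun τ v => c τ v ω) v₀ τ = some v} := by
  induction τ generalizing v with
  | zero => exact @MeasurableSet.const _ m (some v₀ = some v)
  | succ τ ih =>
    rw [setOf_walk_succ]
    exact MeasurableSet.iUnion fun u =>
      (ih (fun τ' h => hc τ' (h.trans (Nat.lt_succ_self _))) u).inter
        (Choice.measurableSet_setOf_eq (hc τ (Nat.lt_succ_self _) u) (fun x => x.target = some v))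

theorem measurableSet_picks {V Ω : Type*} [Fintype V] {m : MeasurableSpace Ω}
    {c : ℕ → V → Ω → Choice V} (v₀ : V) {τ : ℕ} (hc : ∀ τ' ≤ τ, ∀ v, Measurable[m] (c τ' v))
    (l : V × V) : MeasurableSet[m] {ω | Picks (fun τ v => c τ v ω) v₀ τ l} := by
  rw [setOf_picks]
  exact MeasurableSet.iUnion fun u => (measurableSet_walk v₀ (fun τ' h => hc τ' h.le) u).inter
    (Choice.measurableSet_setOf_eq (hc τ le_rfl u) (fun x => x = Choice.take l))

theorem measurable_iSup_comap {Ω ι β : Type*} [mβ : MeasurableSpace β] (c : ι → Ω → β) {S : Set ι}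
    {i : ι} (hi : i ∈ S) : Measurable[⨆ i ∈ S, mβ.comap (c i)] (c i) :=
  measurable_iff_comap_le.2 (le_iSup₂_of_le i hi le_rfl)

section WalkLaw

variable {V Ω : Type*} [Fintype V] [DecidableEq V] [MeasurableSpace Ω] {μ : Measure Ω}
  [IsProbabilityMeasure μ] {c : ℕ → V → Ω → Choice V}

/-- The position at age `τ` depends only on selections at earlier ages, which are independent of the
selection made at age `τ`. -/
theorem prob_walk_inter (hm : ∀ τ v, Measurable (c τ v))
    (hi : iIndepFun (fun i : ℕ × V => c i.1 i.2) μ) (v₀ : V) (τ : ℕ) (v : V) (l : V × V) :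
    μ.real ({ω | walk (fun τ v => c τ v ω) v₀ τ = some v} ∩ {ω | c τ v ω = Choice.take l})
      = μ.real {ω | walk (fun τ v => c τ v ω) v₀ τ = some v} *
        μ.real {ω | c τ v ω = Choice.take l} := by
  have hdisj : Disjoint {i : ℕ × V | i.1 < τ} {(τ, v)} := by
    rw [Set.disjoint_singleton_right]
    exact lt_irrefl τ
  have h := indep_iSup_of_disjoint (fun i : ℕ × V => (hm i.1 i.2).comap_le) hi.iIndep hdisj
  rw [Indep_iff] at h
  rw [measureReal_def, measureReal_def, measureReal_def, ← ENNReal.toReal_mul]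
  congr 1
  refine h _ _ (measurableSet_walk v₀ (fun τ' hτ' u => ?_) v)
    (Choice.measurableSet_setOf_eq (P := fun x => x = Choice.take l) ?_)
  · exact measurable_iSup_comap (fun i : ℕ × V => c i.1 i.2) (i := (τ', u)) hτ'
  · exact measurable_iSup_comap (fun i : ℕ × V => c i.1 i.2) (i := (τ, v)) rfl

theorem prob_picks_eq_sum (hm : ∀ τ v, Measurable (c τ v))
    (hi : iIndepFun (fun i : ℕ × V => c i.1 i.2) μ) (v₀ : V) (τ : ℕ) (l : V × V) :
    μ.real {ω | Picks (fun τ v => c τ v ω) v₀ τ l}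
      = ∑ v, μ.real {ω | walk (fun τ v => c τ v ω) v₀ τ = some v} *
        μ.real {ω | c τ v ω = Choice.take l} := by
  rw [setOf_picks, measureReal_iUnion_fintype]
  · exact Finset.sum_congr rfl fun v _ => prob_walk_inter hm hi v₀ τ v l
  · intro v v' hv
    refine Set.disjoint_left.2 fun ω h h' => hv ?_
    have h1 : walk (fun τ v => c τ v ω) v₀ τ = some v := h.1
    have h2 : walk (fun τ v => c τ v ω) v₀ τ = some v' := h'.1
    rw [h1] at h2
    exact Option.some.inj h2
  · exact fun v => (measurableSet_walk v₀ (fun τ' _ => hm τ') v).inter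
      (Choice.measurableSet_setOf_eq (hm τ v) (fun x => x = Choice.take l))

theorem prob_walk_succ_eq_sum (hm : ∀ τ v, Measurable (c τ v)) (v₀ : V) (τ : ℕ) (w : V) :
    μ.real {ω | walk (fun τ v => c τ v ω) v₀ (τ + 1) = some w}
      = ∑ l : V × V with l.2 = w, μ.real {ω | Picks (fun τ v => c τ v ω) v₀ τ l} := by
  rw [← measureReal_biUnion_finset]
  · congr 1
    ext ω
    simp only [Set.mem_ofPred_eq, Finset.mem_filter, Finset.mem_univ, true_and, Set.mem_iUnion,
      exists_prop, walk_succ_eq_some]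
  · intro l _ l' _ hl
    exact Set.disjoint_left.2 fun ω h h' => hl (Picks.unique h h')
  · exact fun l _ => measurableSet_picks v₀ (fun τ' _ => hm τ') l

end WalkLaw

/-! ### The walk realizes the flow of the linear program -/

namespace Network

variable {V J : Type*} [Fintype V] [DecidableEq V] [Fintype J] [DecidableEq J] (N : Network V J)

/-- The probability that the walk of a packet of type `j` arriving at `s` selects `l` at age `τ`. -/
noncomputable def pickProb (f : J → V × V → ℕ → ℕ → ℝ) (j : J) (s τ : ℕ) (l : V × V) : ℝ :=
  if l ∈ N.extLinks ∧ τ ≤ N.deadline j then f j l τ s else 0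

/-- The mass that the flow `f` sends out of the source. -/
noncomputable def flowValue (f : J → V × V → ℕ → ℕ → ℝ) (j : J) (s : ℕ) : ℝ :=
  ∑ l ∈ N.outLinks (N.src j), f j l 0 s

theorem mem_outLinks {v : V} {l : V × V} : l ∈ N.outLinks v ↔ l ∈ N.extLinks ∧ l.1 = v :=
  Finset.mem_filter

theorem mem_inLinks {v : V} {l : V × V} : l ∈ N.inLinks v ↔ l ∈ N.extLinks ∧ l.2 = v :=
  Finset.mem_filter

variable {N} {T : ℕ} {lam : J → ℕ → ℝ} {ε : ℝ} {f : J → V × V → ℕ → ℕ → ℝ}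

theorem FNSFeasible.pickProb_nonneg (hf : N.FNSFeasible T lam ε f) {j : J} {s : ℕ}
    (hs : s ∈ Finset.Icc 1 T) (τ : ℕ) (l : V × V) : 0 ≤ N.pickProb f j s τ l := by
  unfold pickProb
  split_ifs with h
  · exact hf.nonneg j l h.1 τ (h.2.trans (N.deadline_le_dmax j)) s hs
  · exact le_rfl

/-- Conservation summed over all nodes: grouping the links by head at one age and by tail at the
next shows that the total mass does not change with age. -/
theorem FNSFeasible.sum_extLinks (hf : N.FNSFeasible T lam ε f) {j : J} {s : ℕ}
    (hs : s ∈ Finset.Icc 1 T) {τ : ℕ} (hτ : τ ≤ N.dmax) :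
    ∑ l ∈ N.extLinks, f j l τ s = N.flowValue f j s := by
  induction τ with
  | zero =>
    rw [flowValue, outLinks, Finset.sum_filter]
    refine Finset.sum_congr rfl fun l hl => ?_
    split_ifs with h
    · rfl
    · exact hf.source j s hs l hl (by simp [mem_outLinks, h])
  | succ τ ih =>
    rw [← ih (by omega), ← Finset.sum_fiberwise N.extLinks Prod.fst,
      ← Finset.sum_fiberwise N.extLinks Prod.snd]
    exact Finset.sum_congr rfl fun v _ =>
      (hf.conservation v (τ + 1) (Finset.mem_Icc.2 ⟨by omega, hτ⟩) j s hs).symm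

theorem FNSFeasible.flowValue_nonneg (hf : N.FNSFeasible T lam ε f) {j : J} {s : ℕ}
    (hs : s ∈ Finset.Icc 1 T) : 0 ≤ N.flowValue f j s :=
  Finset.sum_nonneg fun l hl => hf.nonneg j l (N.mem_outLinks.1 hl).1 0 (Nat.zero_le _) s hs

variable {Ω : Type*} [MeasurableSpace Ω] {μ : Measure Ω} [IsProbabilityMeasure μ]
  {c : ℕ → V → Ω → Choice V} {j : J} {s : ℕ}

/-- The random walk realizes the flow. -/
theorem FNSFeasible.prob_picks (hf : N.FNSFeasible T lam ε f) (hs : s ∈ Finset.Icc 1 T)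
    (hm : ∀ τ v, Measurable (c τ v)) (hi : iIndepFun (fun i : ℕ × V => c i.1 i.2) μ)
    (hl : ∀ τ ≤ N.deadline j, ∀ v l,
      μ.real {ω | c τ v ω = Choice.take l} = N.forwardProb f j s τ v l)
    {τ : ℕ} (hτ : τ ≤ N.deadline j) (l : V × V) :
    μ.real {ω | Picks (fun τ v => c τ v ω) (N.src j) τ l} = N.pickProb f j s τ l := by
  induction τ generalizing l with
  | zero =>
    rw [prob_picks_eq_sum hm hi, Finset.sum_eq_single (N.src j)]
    · rw [hl 0 hτ, forwardProb, pickProb]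
      by_cases h : l ∈ N.outLinks (N.src j)
      · simp [walk, h, (N.mem_outLinks.1 h).1]
      · by_cases h' : l ∈ N.extLinks
        · simp [h, hf.source j s hs l h' h]
        · simp [h, h']
    · intro v _ hv
      simp [walk, hv.symm]
    · simp
  | succ τ ih =>
    -- By induction the probability of being at `v` is the inflow of `v`, which conservation turns
    -- into the outflow, the denominator of the forwarding probability.
    have hw : ∀ v, μ.real {ω | walk (fun τ v => c τ v ω) (N.src j) (τ + 1) = some v}
        = ∑ l ∈ N.outLinks v, f j l (τ + 1) s := by
      intro v
      rw [prob_walk_succ_eq_sum hm, ← hf.conservation v (τ + 1) (Finset.mem_Icc.2 ⟨by omega,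
        hτ.trans (N.deadline_le_dmax j)⟩) j s hs, Nat.add_sub_cancel, inLinks, Finset.sum_filter,
        Finset.sum_filter, ← Finset.sum_subset (Finset.subset_univ N.extLinks)]
      · refine Finset.sum_congr rfl fun l hlv => ?_
        rw [ih (by omega), pickProb, if_pos (⟨hlv, by omega⟩ : _ ∧ τ ≤ N.deadline j)]
      · intro l _ hlv
        rw [ih (by omega), pickProb,
          if_neg (fun h : _ ∧ τ ≤ N.deadline j => hlv h.1), ite_self]
    rw [prob_picks_eq_sum hm hi, Finset.sum_eq_single l.1]
    · rw [hl _ hτ, hw, forwardProb, pickProb]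
      by_cases h : l ∈ N.extLinks
      · have hmem : l ∈ N.outLinks l.1 := N.mem_outLinks.2 ⟨h, rfl⟩
        rw [if_pos hmem, if_neg (Nat.succ_ne_zero τ), if_pos ⟨h, hτ⟩]
        -- If the outflow is zero, the quotient is zero by convention; `f` also vanishes on each
        -- outgoing link, being nonnegative.
        refine mul_div_cancel_of_imp' fun h0 => ?_
        refine (Finset.sum_eq_zero_iff_of_nonneg fun l' hl' => ?_).1 h0 l hmem
        exact hf.nonneg j l' (N.mem_outLinks.1 hl').1 _ (hτ.trans (N.deadline_le_dmax j)) s hs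
      · simp [h, mem_outLinks]
    · intro v _ hv
      rw [hl _ hτ, forwardProb, if_neg (fun h => hv (N.mem_outLinks.1 h).2.symm), mul_zero]
    · simp

/-- At the deadline age all mass lies on links into the destination, and by conservation it is all
the mass that left the source. -/
theorem FNSFeasible.prob_walk_dst (hf : N.FNSFeasible T lam ε f) (hs : s ∈ Finset.Icc 1 T)
    (hm : ∀ τ v, Measurable (c τ v)) (hi : iIndepFun (fun i : ℕ × V => c i.1 i.2) μ)
    (hl : ∀ τ ≤ N.deadline j, ∀ v l,
      μ.real {ω | c τ v ω = Choice.take l} = N.forwardProb f j s τ v l) :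
    μ.real {ω | walk (fun τ v => c τ v ω) (N.src j) (N.deadline j + 1) = some (N.dst j)}
      = N.flowValue f j s := by
  rw [prob_walk_succ_eq_sum hm, ← hf.sum_extLinks hs (N.deadline_le_dmax j), Finset.sum_filter,
    ← Finset.sum_subset (Finset.subset_univ N.extLinks)]
  · refine Finset.sum_congr rfl fun l hlv => ?_
    rw [hf.prob_picks hs hm hi hl le_rfl, pickProb,
      if_pos (⟨hlv, le_rfl⟩ : _ ∧ N.deadline j ≤ N.deadline j)]
    split_ifs with h
    · rfl
    · exact (hf.destination j s hs l hlv (fun h' => h (N.mem_inLinks.1 h').2)).symm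
  · intro l _ hlv
    rw [hf.prob_picks hs hm hi hl le_rfl, pickProb,
      if_neg (fun h : _ ∧ N.deadline j ≤ N.deadline j => hlv h.1), ite_self]

/-- Leaving the source is as likely as reaching the destination, so up to null sets only the first
selection can drop a packet. -/
theorem FNSFeasible.prob_walk_one (hf : N.FNSFeasible T lam ε f) (hs : s ∈ Finset.Icc 1 T)
    (hm : ∀ τ v, Measurable (c τ v)) (hi : iIndepFun (fun i : ℕ × V => c i.1 i.2) μ)
    (hl : ∀ τ ≤ N.deadline j, ∀ v l,
      μ.real {ω | c τ v ω = Choice.take l} = N.forwardProb f j s τ v l) :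
    μ.real (⋃ l : V × V, {ω | Picks (fun τ v => c τ v ω) (N.src j) 0 l}) = N.flowValue f j s := by
  rw [measureReal_iUnion_fintype, ← hf.sum_extLinks hs (Nat.zero_le _),
    ← Finset.sum_subset (Finset.subset_univ N.extLinks)]
  · refine Finset.sum_congr rfl fun l hlv => ?_
    rw [hf.prob_picks hs hm hi hl (Nat.zero_le _), pickProb, if_pos ⟨hlv, Nat.zero_le _⟩]
  · intro l _ hlv
    rw [hf.prob_picks hs hm hi hl (Nat.zero_le _), pickProb, if_neg (fun h => hlv h.1)]
  · intro l l' hll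
    exact Set.disjoint_left.2 fun ω h h' => hll (Picks.unique h h')
  · exact fun l => measurableSet_picks _ (fun τ' _ => hm τ') l

theorem exists_picks_of_walk {c : ℕ → V → Choice V} {v₀ w : V} {d : ℕ}
    (h : walk c v₀ (d + 1) = some w) : ∀ τ ≤ d, ∃ l, Picks c v₀ τ l := by
  intro τ hτ
  induction d generalizing w with
  | zero =>
    obtain ⟨l, -, hl⟩ := walk_succ_eq_some.1 h
    obtain rfl : τ = 0 := by omega
    exact ⟨l, hl⟩
  | succ d ih =>
    obtain ⟨l, -, hl⟩ := walk_succ_eq_some.1 h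
    rcases Nat.lt_or_ge τ (d + 1) with h' | h'
    · obtain ⟨v, hv, -⟩ := hl
      exact ih hv (by omega)
    · obtain rfl : τ = d + 1 := by omega
      exact ⟨l, hl⟩

open Classical in
/-- A walk along links that ends at the destination is a route. -/
theorem sum_picks_le_maxRouteLength {c : ℕ → V → Choice V}
    (hout : ∀ τ ≤ N.deadline j, ∀ v l, c τ v = Choice.take l → l ∈ N.outLinks v)
    (hd : walk c (N.src j) (N.deadline j + 1) = some (N.dst j)) :
    ∑ τ ∈ Finset.range (N.deadline j + 1), ∑ l ∈ N.links,
      (if Picks c (N.src j) τ l then (1 : ℝ) else 0) ≤ N.maxRouteLength := by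
  choose k hk using fun τ : Fin (N.deadline j + 1) =>
    exists_picks_of_walk hd τ (Nat.lt_succ_iff.1 τ.2)
  have hwalk : ∀ τ : Fin (N.deadline j + 1), walk c (N.src j) τ = some (k τ).1 ∧ k τ ∈ N.extLinks := by
    intro τ
    obtain ⟨v, hv, hc⟩ := hk τ
    have := N.mem_outLinks.1 (hout τ (Nat.lt_succ_iff.1 τ.2) v _ hc)
    exact ⟨by rw [this.2, hv], this.1⟩
  have hroute : k ∈ N.routes j := by
    rw [routes, Finset.mem_filter]
    refine ⟨Finset.mem_univ _, fun τ => (hwalk τ).2, fun τ => ?_, ?_, ?_⟩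
    · have h1 := (hk τ.castSucc).walk_succ
      have h2 := (hwalk τ.succ).1
      simp only [Fin.val_castSucc, Fin.val_succ] at h1 h2
      rw [h1] at h2
      exact Option.some.inj h2
    · have h2 := (hwalk 0).1
      simp only [Fin.val_zero, walk, Option.some.injEq] at h2
      exact N.mem_outLinks.2 ⟨(hwalk 0).2, h2.symm⟩
    · have h1 := (hk (Fin.last _)).walk_succ
      simp only [Fin.val_last] at h1
      rw [h1] at hd
      exact N.mem_inLinks.2 ⟨(hwalk _).2, Option.some.inj hd⟩
  have hcard : (Finset.univ.filter fun τ => k τ ∈ N.links).card ≤ N.maxRouteLength :=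
    (Finset.le_sup (f := fun k : Fin (N.deadline j + 1) → V × V =>
      (Finset.univ.filter fun τ => k τ ∈ N.links).card) hroute).trans
      (Finset.le_sup (f := fun j : J => (N.routes j).sup fun k =>
        (Finset.univ.filter fun τ => k τ ∈ N.links).card) (Finset.mem_univ j))
  refine le_trans (le_of_eq ?_) (Nat.cast_le.2 hcard)
  rw [Finset.sum_range, Finset.card_filter, Nat.cast_sum]
  refine Finset.sum_congr rfl fun τ _ => ?_
  have : ∀ l, Picks c (N.src j) τ l ↔ k τ = l := fun l =>
    ⟨fun h => (hk τ).unique h, fun h => h ▸ hk τ⟩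
  simp [this]

theorem not_picks_of_walk_one {c : ℕ → V → Choice V} {v₀ : V} (h : ∀ l, ¬ Picks c v₀ 0 l) (τ : ℕ)
    (l : V × V) : ¬ Picks c v₀ τ l := by
  cases τ with
  | zero => exact h l
  | succ τ =>
    rintro ⟨v, hv, -⟩
    obtain ⟨l', hl'⟩ := exists_picks_of_walk hv 0 (Nat.zero_le _)
    exact h l' hl'

/-- The left side is the expected number of links on a walk. Almost surely a walk is either dropped
at its source, using no link, or is a route to the destination with at most `maxRouteLength` links.
-/
theorem FNSFeasible.sum_links_le (hf : N.FNSFeasible T lam ε f) (hs : s ∈ Finset.Icc 1 T)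
    (hm : ∀ τ v, Measurable (c τ v)) (hi : iIndepFun (fun i : ℕ × V => c i.1 i.2) μ)
    (hl : ∀ τ ≤ N.deadline j, ∀ v l,
      μ.real {ω | c τ v ω = Choice.take l} = N.forwardProb f j s τ v l) :
    ∑ τ ∈ Finset.range (N.deadline j + 1), ∑ l ∈ N.links, N.pickProb f j s τ l
      ≤ N.maxRouteLength * N.flowValue f j s := by
  classical
  set E : Set Ω :=
    {ω | walk (fun τ v => c τ v ω) (N.src j) (N.deadline j + 1) = some (N.dst j)} with hE
  have hEm : MeasurableSet E := measurableSet_walk _ (fun τ' _ => hm τ') _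
  set G : Set Ω := ⋃ l : V × V, {ω | Picks (fun τ v => c τ v ω) (N.src j) 0 l} with hG
  have hpm : ∀ τ l, MeasurableSet {ω | Picks (fun τ v => c τ v ω) (N.src j) τ l} :=
    fun τ l => measurableSet_picks _ (fun τ' _ => hm τ') l
  have hEG : E ⊆ G := fun ω hω => by
    obtain ⟨l, h⟩ := exists_picks_of_walk (show walk _ _ _ = _ from hω) 0 (Nat.zero_le _)
    exact Set.mem_iUnion.2 ⟨l, h⟩
  -- Arriving implies having left the source, and both events have the same probability.
  have hae : E =ᵐ[μ] G := by
    refine ae_eq_of_subset_of_measure_ge hEG (le_of_eq ?_) hEm.nullMeasurableSet (measure_ne_top _ _)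
    have h := (hf.prob_walk_one hs hm hi hl).trans (hf.prob_walk_dst hs hm hi hl).symm
    rwa [measureReal_def, measureReal_def,
      ENNReal.toReal_eq_toReal_iff' (measure_ne_top _ _) (measure_ne_top _ _)] at h
  have hout : ∀ᵐ ω ∂μ, ∀ τ ≤ N.deadline j, ∀ v l, c τ v ω = Choice.take l →
      l ∈ N.outLinks v := by
    simp only [ae_all_iff]
    intro τ hτ v l
    by_cases h : l ∈ N.outLinks v
    · exact Filter.Eventually.of_forall fun ω _ => h
    · have := hl τ hτ v l
      rw [forwardProb, if_neg h, measureReal_eq_zero_iff] at this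
      filter_upwards [measure_eq_zero_iff_ae_notMem.1 this] with ω hω hc
      exact absurd hc hω
  have hpt : ∀ᵐ ω ∂μ, ∑ τ ∈ Finset.range (N.deadline j + 1), ∑ l ∈ N.links,
      Set.indicator {ω | Picks (fun τ v => c τ v ω) (N.src j) τ l} (fun _ => (1 : ℝ)) ω
      ≤ E.indicator (fun _ => (N.maxRouteLength : ℝ)) ω := by
    filter_upwards [hae.mem_iff, hout] with ω h1 h2
    by_cases hω : ω ∈ E
    · rw [Set.indicator_of_mem hω]
      simpa only [Set.indicator_apply, Set.mem_ofPred_eq] using sum_picks_le_maxRouteLength h2 hω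
    · rw [Set.indicator_of_notMem hω]
      rw [h1, hG, Set.mem_iUnion, not_exists] at hω
      refine le_of_eq (Finset.sum_eq_zero fun τ _ => Finset.sum_eq_zero fun l _ => ?_)
      exact Set.indicator_of_notMem
        (s := {ω | Picks (fun τ v => c τ v ω) (N.src j) τ l}) (not_picks_of_walk_one hω τ l) _
  have hint : ∀ τ l, Integrable
      (Set.indicator {ω | Picks (fun τ v => c τ v ω) (N.src j) τ l} (fun _ => (1 : ℝ))) μ :=
    fun τ l => (integrable_const 1).indicator (hpm τ l)
  have := integral_mono_ae (integrable_finsetSum _ fun τ _ => integrable_finsetSum _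
    fun l _ => hint τ l) ((integrable_const (N.maxRouteLength : ℝ)).indicator hEm) hpt
  rw [integral_indicator_const _ hEm, hf.prob_walk_dst hs hm hi hl, smul_eq_mul, mul_comm,
    integral_finsetSum _ fun τ _ => integrable_finsetSum _ fun l _ => hint τ l] at this
  refine le_trans (le_of_eq (Finset.sum_congr rfl fun τ hτ => ?_)) this
  rw [integral_finsetSum _ fun l _ => hint τ l]
  refine Finset.sum_congr rfl fun l _ => ?_
  rw [integral_indicator_const _ (hpm τ l), smul_eq_mul, mul_one,
    hf.prob_picks hs hm hi hl (Nat.lt_succ_iff.1 (Finset.mem_range.1 hτ))]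

end Network

/-! ### Overload probability for fixed arrivals -/

/-- The expectation of a product of random variables that depend on disjoint blocks of independent
σ-algebras factorizes. -/
theorem integral_prod_of_disjoint_blocks {Ω ι π : Type*} [DecidableEq π] [MeasurableSpace Ω]
    {μ : Measure Ω} [IsProbabilityMeasure μ] {m : ι → MeasurableSpace Ω} (hle : ∀ i, m i ≤ ‹_›)
    (hi : iIndep m μ) {B : π → Set ι} (hB : Pairwise fun p q => Disjoint (B p) (B q))
    {g : π → Ω → ℝ} (hg : ∀ p, Measurable[⨆ i ∈ B p, m i] (g p)) (P : Finset π) :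
    ∫ ω, ∏ p ∈ P, g p ω ∂μ = ∏ p ∈ P, ∫ ω, g p ω ∂μ := by
  have hgm : ∀ p, Measurable (g p) := fun p => (hg p).mono (iSup₂_le fun i _ => hle i) le_rfl
  induction P using Finset.induction_on with
  | empty => simp
  | insert p P hp ih =>
    simp only [Finset.prod_insert hp]
    rw [← ih]
    have hdisj : Disjoint (B p) (⋃ q ∈ P, B q) := by
      rw [Set.disjoint_iUnion₂_right]
      exact fun q hq => hB fun h => hp (h ▸ hq)
    have hind : IndepFun (g p) (fun ω => ∏ q ∈ P, g q ω) μ := by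
      rw [IndepFun_iff_Indep]
      refine indep_of_indep_of_le_right (indep_of_indep_of_le_left
        (indep_iSup_of_disjoint hle hi hdisj) ?_) ?_
      · exact measurable_iff_comap_le.1 (hg p)
      · refine measurable_iff_comap_le.1 (Finset.measurable_fun_prod P fun q hq => ?_)
        refine (hg q).mono ?_ le_rfl
        exact iSup₂_le fun i hi => le_iSup₂_of_le i (Set.mem_iUnion₂.2 ⟨q, hq, hi⟩) le_rfl
    exact hind.integral_fun_mul_eq_mul_integral (hgm p).aestronglyMeasurable
      (Finset.measurable_fun_prod P fun q _ => hgm q).aestronglyMeasurable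

/-- A tail bound for the number of independent events that occur jointly with a given one. -/
theorem prob_mem_and_lt_card_le {Ω ι π : Type*} [DecidableEq π] [MeasurableSpace Ω]
    {μ : Measure Ω} [IsProbabilityMeasure μ] {m : ι → MeasurableSpace Ω} (hle : ∀ i, m i ≤ ‹_›)
    (hi : iIndep m μ) {B : π → Set ι} (hB : Pairwise fun p q => Disjoint (B p) (B q))
    {E : π → Set Ω} [∀ ω, DecidablePred fun q => ω ∈ E q]
    (hE : ∀ p, MeasurableSet[⨆ i ∈ B p, m i] (E p)) {P : Finset π} {p : π}
    (hp : p ∈ P) {u : ℝ} (hu : 0 ≤ u) (K : ℕ) :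
    μ.real {ω | ω ∈ E p ∧ K < (P.filter fun q => ω ∈ E q).card}
      ≤ μ.real (E p) / (1 + u) ^ K * ∏ q ∈ P.erase p, (1 + u * μ.real (E q)) := by
  have hEm : ∀ q, MeasurableSet (E q) := fun q => (iSup₂_le fun i _ => hle i) _ (hE q)
  have hu1 : 0 < 1 + u := by linarith
  -- On `E p` the product of the `g q` is `(1 + u)` to the number of events that occur; off `E p` it
  -- is zero. Thus Markov's inequality is restricted to `E p` while the expectation still
  -- factorizes.
  set g : π → Ω → ℝ := fun q =>
    if q = p then (E q).indicator fun _ => 1 + u else fun ω => 1 + (E q).indicator (fun _ => u) ω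
    with hg
  have hgm : ∀ q, ∀ m : MeasurableSpace Ω, MeasurableSet[m] (E q) → Measurable[m] (g q) := by
    intro q m hm
    simp only [hg]
    split_ifs
    · exact measurable_const.indicator hm
    · exact (measurable_const.indicator hm).const_add 1
  have hg0 : ∀ q ω, 0 ≤ g q ω := by
    intro q ω
    simp only [hg]
    split_ifs
    · exact Set.indicator_nonneg (fun _ _ => hu1.le) ω
    · exact add_nonneg zero_le_one (Set.indicator_nonneg (fun _ _ => hu) ω)
  have hg1 : ∀ q ω, g q ω ≤ 1 + u := by
    intro q ω
    simp only [hg]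
    split_ifs
    · exact Set.indicator_apply_le' (fun _ => le_rfl) (fun _ => hu1.le)
    · exact add_le_add le_rfl (Set.indicator_apply_le' (fun _ => le_rfl) (fun _ => hu))
  have hprod : ∫ ω, ∏ q ∈ P, g q ω ∂μ
      = μ.real (E p) * (1 + u) * ∏ q ∈ P.erase p, (1 + u * μ.real (E q)) := by
    rw [integral_prod_of_disjoint_blocks hle hi hB fun q => hgm q _ (hE q),
      ← Finset.mul_prod_erase _ _ hp]
    congr 1
    · simp only [hg, if_true]
      rw [integral_indicator_const _ (hEm p), smul_eq_mul]
    · refine Finset.prod_congr rfl fun q hq => ?_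
      simp only [hg, if_neg (Finset.ne_of_mem_erase hq)]
      rw [integral_add (integrable_const _) ((integrable_const u).indicator (hEm q)),
        integral_indicator_const _ (hEm q)]
      simp [mul_comm]
  have hpt : {ω | ω ∈ E p ∧ K < (P.filter fun q => ω ∈ E q).card} ⊆
      {ω | (1 + u) ^ (K + 1) ≤ ∏ q ∈ P, g q ω} := by
    rintro ω ⟨h1, h2⟩
    have h3 : ∏ q ∈ P, g q ω = (1 + u) ^ (P.filter fun q => ω ∈ E q).card := by
      rw [← Finset.prod_const, Finset.prod_filter]
      refine Finset.prod_congr rfl fun q _ => ?_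
      simp only [hg]
      by_cases hq : ω ∈ E q
      · rw [if_pos hq]
        split_ifs <;> simp [hq]
      · rw [if_neg hq, if_neg (fun h => hq (by rw [h]; exact h1))]
        simp [hq]
    exact (pow_le_pow_right₀ (by linarith) h2).trans h3.ge
  have hint : Integrable (fun ω => ∏ q ∈ P, g q ω) μ := by
    refine Integrable.of_bound (Finset.measurable_fun_prod _ fun q _ =>
      hgm q _ (hEm q)).aestronglyMeasurable (∏ _q ∈ P, (1 + u)) ?_
    refine Filter.Eventually.of_forall fun ω => ?_
    rw [Real.norm_of_nonneg (Finset.prod_nonneg fun q _ => hg0 q ω)]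
    exact Finset.prod_le_prod (fun q _ => hg0 q ω) fun q _ => hg1 q ω
  have hmarkov := mul_meas_ge_le_integral_of_nonneg
    (Filter.Eventually.of_forall fun ω => Finset.prod_nonneg fun q _ => hg0 q ω) hint
    ((1 + u) ^ (K + 1))
  rw [hprod] at hmarkov
  -- Exceeding `K` means at least `K + 1` events; the extra factor `1 + u` cancels the one
  -- contributed by `p`.
  refine (measureReal_mono hpt).trans (le_of_mul_le_mul_left (hmarkov.trans (le_of_eq ?_))
    (pow_pos hu1 (K + 1)))
  rw [pow_succ (1 + u) K]
  field_simp

namespace Network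

variable {V J : Type*} [Fintype V] [DecidableEq V] [Fintype J] [DecidableEq J] (N : Network V J)

/-- The probability that a packet of type `j` arriving at `s` selects `l` in slot `t` if capacities
are ignored. -/
noncomputable def slotProb (f : J → V × V → ℕ → ℕ → ℝ) (l : V × V) (t : ℕ) (j : J) (s : ℕ) : ℝ :=
  if s ≤ t then N.pickProb f j s (t - s) l else 0

theorem slotProb_add (f : J → V × V → ℕ → ℕ → ℝ) (l : V × V) (s τ : ℕ) (j : J) :
    N.slotProb f l (s + τ) j s = N.pickProb f j s τ l := by
  rw [slotProb, if_pos (Nat.le_add_right _ _), Nat.add_sub_cancel_left]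

variable {N} {T : ℕ} {lam : J → ℕ → ℝ} {ε : ℝ} {f : J → V × V → ℕ → ℕ → ℝ}
variable {Ω : Type*} [MeasurableSpace Ω] {μ : Measure Ω} [IsProbabilityMeasure μ]
  {c : Packet J → ℕ → V → Ω → Choice V} {a : J → ℕ → Ω → ℕ}

theorem FNSFeasible.slotProb_nonneg (hf : N.FNSFeasible T lam ε f) {j : J} {s : ℕ}
    (hs : s ∈ Finset.Icc 1 T) (t : ℕ) (l : V × V) : 0 ≤ N.slotProb f l t j s := by
  unfold slotProb
  split_ifs
  · exact hf.pickProb_nonneg hs _ l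
  · exact le_rfl

theorem IsForwardingRandomness.packet (hc : N.IsForwardingRandomness μ T a f c) (p : Packet J) :
    iIndepFun (fun i : ℕ × V => c p i.1 i.2) μ :=
  hc.indep.precomp (g := fun i : ℕ × V => (p, i)) fun _ _ h => (Prod.mk.inj h).2

theorem measurableSet_picksInSlot {m : MeasurableSpace Ω} {p : Packet J}
    (hc : ∀ τ v, Measurable[m] (c p τ v)) (t : ℕ) (l : V × V) :
    MeasurableSet[m] {ω | N.PicksInSlot (fun p τ v => c p τ v ω) t l p} := by
  have h : {ω | N.PicksInSlot (fun p τ v => c p τ v ω) t l p} =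
      {_ω | p.2.1 ≤ t ∧ t ≤ p.2.1 + N.deadline p.1} ∩
        {ω | Picks (fun τ v => c p τ v ω) (N.src p.1) (t - p.2.1) l} := by
    ext ω
    simp [PicksInSlot, and_assoc]
  rw [h]
  exact (@MeasurableSet.const _ m _).inter (measurableSet_picks _ (fun τ' _ => hc τ') l)

theorem IsForwardingRandomness.prob_picksInSlot (hc : N.IsForwardingRandomness μ T a f c)
    (hf : N.FNSFeasible T lam ε f) {p : Packet J} (hp : p.2.1 ∈ Finset.Icc 1 T) (t : ℕ)
    (l : V × V) :
    μ.real {ω | N.PicksInSlot (fun p τ v => c p τ v ω) t l p} = N.slotProb f l t p.1 p.2.1 := by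
  obtain ⟨j, s, n⟩ := p
  simp only [PicksInSlot, slotProb]
  by_cases h : s ≤ t
  · by_cases h' : t ≤ s + N.deadline j
    · simp only [h, h', true_and, if_true]
      exact hf.prob_picks hp (hc.measurable _) (hc.packet _)
        (fun τ hτ v l => hc.law j s hp n τ hτ v l) (by omega) l
    · have : ¬ (t - s ≤ N.deadline j) := by omega
      simp [h', pickProb, this]
  · simp [h]

/-- The probability that a packet meets an overloaded link, by an exponential moment bound. -/
theorem IsForwardingRandomness.prob_overload_le (hc : N.IsForwardingRandomness μ T a f c)
    (hf : N.FNSFeasible T lam ε f) {u : ℝ} (hu : 0 ≤ u) (A : J → ℕ → ℕ) {p : Packet J}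
    (hp : p ∈ arrivedPackets T A) (t : ℕ) (l : V × V) :
    μ.real {ω | N.PicksInSlot (fun p τ v => c p τ v ω) t l p ∧
        N.cap l < N.load T A (fun p τ v => c p τ v ω) t l}
      ≤ N.slotProb f l t p.1 p.2.1 / (1 + u) ^ N.cap l *
        ((∏ j, ∏ s ∈ Finset.Icc 1 T, (1 + u * N.slotProb f l t j s) ^ A j s) /
          (1 + u * N.slotProb f l t p.1 p.2.1)) := by
  classical
  set E : Packet J → Set Ω := fun q => {ω | N.PicksInSlot (fun p τ v => c p τ v ω) t l q} with hE
  have hPE : ∀ q ∈ arrivedPackets T A, μ.real (E q) = N.slotProb f l t q.1 q.2.1 := fun q hq =>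
    hc.prob_picksInSlot hf (mem_arrivedPackets.1 hq).1 t l
  have h := prob_mem_and_lt_card_le (μ := μ) (E := E)
    (m := fun i : Packet J × ℕ × V => MeasurableSpace.comap (c i.1 i.2.1 i.2.2) inferInstance)
    (B := fun q => {i | i.1 = q}) (fun i => (hc.measurable i.1 i.2.1 i.2.2).comap_le)
    hc.indep.iIndep (fun q q' hqq => Set.disjoint_left.2 fun i hi hi' => hqq (hi.symm.trans hi'))
    (fun q => ?_) hp hu (N.cap l)
  · have hxp : 0 < 1 + u * N.slotProb f l t p.1 p.2.1 := by
      have := mul_nonneg hu (hf.slotProb_nonneg (mem_arrivedPackets.1 hp).1 t l (j := p.1))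
      linarith
    -- The factor of `p` is restored so that the product becomes the full generating function of the
    -- arrivals, and is divided out again.
    have hall : (∏ j, ∏ s ∈ Finset.Icc 1 T, (1 + u * N.slotProb f l t j s) ^ A j s)
        = (1 + u * N.slotProb f l t p.1 p.2.1) *
          ∏ q ∈ (arrivedPackets T A).erase p, (1 + u * μ.real (E q)) := by
      rw [← hPE p hp, Finset.mul_prod_erase _ (fun q => 1 + u * μ.real (E q)) hp,
        Finset.prod_congr rfl fun q (hq : q ∈ arrivedPackets T A) => by rw [hPE q hq],
        prod_arrivedPackets]
      simp
    rw [hall, mul_div_cancel_left₀ _ hxp.ne', ← hPE p hp]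
    exact h
  · exact measurableSet_picksInSlot (fun τ v => measurable_iSup_comap
      (fun i : Packet J × ℕ × V => c i.1 i.2.1 i.2.2) (i := (q, τ, v)) rfl) t l

end Network

/-! ### From schedules of the integer program to flows -/

namespace Network

variable {V J : Type*} [Fintype V] [DecidableEq V] [Fintype J] [DecidableEq J] (N : Network V J)

/-- The link used at each age by a packet on the route `k` that waits at its destination. -/
def extendRoute {j : J} (k : Fin (N.deadline j + 1) → V × V) (τ : ℕ) : V × V :=
  if h : τ < N.deadline j + 1 then k ⟨τ, h⟩ else (N.dst j, N.dst j)

/-- The number of packets of type `j` arriving at `s` that a schedule sends over `l` at age `τ`. -/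
noncomputable def scheduleFlow (A : J → ℕ → ℕ)
    (y : (j : J) → ℕ → ℕ → (Fin (N.deadline j + 1) → V × V) → ℕ) (j : J) (l : V × V) (τ s : ℕ) :
    ℝ :=
  ∑ n ∈ Finset.range (A j s), ∑ k ∈ N.routes j,
    if N.extendRoute k τ = l then (y j s n k : ℝ) else 0

variable {N}

theorem mem_routes {j : J} {k : Fin (N.deadline j + 1) → V × V} :
    k ∈ N.routes j ↔ N.IsRoute j k := by
  classical
  simp [routes]

theorem extendRoute_zero {j : J} (k : Fin (N.deadline j + 1) → V × V) :
    N.extendRoute k 0 = k 0 := by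
  simp [extendRoute]

theorem extendRoute_deadline {j : J} (k : Fin (N.deadline j + 1) → V × V) :
    N.extendRoute k (N.deadline j) = k (Fin.last _) := by
  simp [extendRoute, Fin.last]

theorem IsRoute.extendRoute_mem {j : J} {k : Fin (N.deadline j + 1) → V × V} (hk : N.IsRoute j k)
    (τ : ℕ) : N.extendRoute k τ ∈ N.extLinks := by
  unfold extendRoute
  split_ifs with h
  · exact hk.1 _
  · exact Finset.mem_union_right _ (by simp)

theorem IsRoute.extendRoute_succ {j : J} {k : Fin (N.deadline j + 1) → V × V} (hk : N.IsRoute j k)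
    (τ : ℕ) : (N.extendRoute k τ).2 = (N.extendRoute k (τ + 1)).1 := by
  rcases lt_trichotomy τ (N.deadline j) with h | h | h
  · have := hk.2.1 ⟨τ, h⟩
    simpa [extendRoute, h, Nat.lt_succ_of_lt h] using this
  · subst h
    rw [extendRoute_deadline, (N.mem_inLinks.1 hk.2.2.2).2]
    simp [extendRoute]
  · have h1 : ¬ τ < N.deadline j + 1 := by omega
    have h2 : ¬ τ < N.deadline j := by omega
    simp [extendRoute, h1, h2]

theorem sum_scheduleFlow (A : J → ℕ → ℕ)
    (y : (j : J) → ℕ → ℕ → (Fin (N.deadline j + 1) → V × V) → ℕ) (j : J) (F : Finset (V × V))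
    (τ s : ℕ) : ∑ l ∈ F, N.scheduleFlow A y j l τ s = ∑ n ∈ Finset.range (A j s),
      ∑ k ∈ N.routes j, if N.extendRoute k τ ∈ F then (y j s n k : ℝ) else 0 := by
  simp only [scheduleFlow]
  rw [Finset.sum_comm]
  refine Finset.sum_congr rfl fun n _ => ?_
  rw [Finset.sum_comm]
  exact Finset.sum_congr rfl fun k _ => Finset.sum_ite_eq _ _ _

theorem scheduleFlow_nonneg (A : J → ℕ → ℕ)
    (y : (j : J) → ℕ → ℕ → (Fin (N.deadline j + 1) → V × V) → ℕ) (j : J) (l : V × V)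
    (τ s : ℕ) : 0 ≤ N.scheduleFlow A y j l τ s :=
  Finset.sum_nonneg fun n _ => Finset.sum_nonneg fun k _ => by positivity

theorem sum_scheduleFlow_source (A : J → ℕ → ℕ)
    (y : (j : J) → ℕ → ℕ → (Fin (N.deadline j + 1) → V × V) → ℕ) (j : J) (s : ℕ) :
    ∑ l ∈ N.outLinks (N.src j), N.scheduleFlow A y j l 0 s
      = ∑ n ∈ Finset.range (A j s), ∑ k ∈ N.routes j, (y j s n k : ℝ) := by
  rw [sum_scheduleFlow]
  refine Finset.sum_congr rfl fun n _ => Finset.sum_congr rfl fun k hk => if_pos ?_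
  rw [extendRoute_zero]
  exact (mem_routes.1 hk).2.2.1

theorem scheduleFlow_conservation (A : J → ℕ → ℕ)
    (y : (j : J) → ℕ → ℕ → (Fin (N.deadline j + 1) → V × V) → ℕ) (j : J) (v : V) (τ s : ℕ) :
    ∑ l ∈ N.inLinks v, N.scheduleFlow A y j l τ s
      = ∑ l ∈ N.outLinks v, N.scheduleFlow A y j l (τ + 1) s := by
  rw [sum_scheduleFlow, sum_scheduleFlow]
  refine Finset.sum_congr rfl fun n _ => Finset.sum_congr rfl fun k hk => ?_
  have hk := mem_routes.1 hk
  simp only [mem_inLinks, mem_outLinks, hk.extendRoute_mem, hk.extendRoute_succ, true_and]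

variable {T : ℕ} {A : J → ℕ → ℕ} {y : (j : J) → ℕ → ℕ → (Fin (N.deadline j + 1) → V × V) → ℕ}

theorem RIFeasible.sum_scheduleFlow_source_le (hy : N.RIFeasible T A y) {j : J} {s : ℕ}
    (hs : s ∈ Finset.Icc 1 T) :
    ∑ l ∈ N.outLinks (N.src j), N.scheduleFlow A y j l 0 s ≤ A j s := by
  rw [sum_scheduleFlow_source]
  calc ∑ n ∈ Finset.range (A j s), ∑ k ∈ N.routes j, (y j s n k : ℝ)
      ≤ ∑ n ∈ Finset.range (A j s), (1 : ℝ) := Finset.sum_le_sum fun n hn => by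
        exact_mod_cast hy.one_choice s hs j n hn
    _ = A j s := by simp

theorem RIFeasible.scheduleFlow_capacity (hy : N.RIFeasible T A y) {l : V × V} (hl : l ∈ N.links)
    {t : ℕ} (ht : t ∈ Finset.Icc 1 (T + N.dmax)) :
    ∑ s ∈ N.window T t, ∑ j, N.scheduleFlow A y j l (t - s) s ≤ N.cap l := by
  classical
  refine le_trans (le_of_eq ?_) (Nat.cast_le.2 (hy.capacity l hl t ht))
  push_cast
  refine Finset.sum_congr rfl fun s _ => Finset.sum_congr rfl fun j _ =>
    Finset.sum_congr rfl fun n _ => ?_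
  rw [Finset.sum_filter]
  refine Finset.sum_congr rfl fun k _ => ?_
  have hiff : N.extendRoute k (t - s) = l ↔ N.UsesAt k (t - s) l := by
    unfold extendRoute UsesAt
    by_cases h : t - s < N.deadline j + 1
    · simp [h]
    -- Beyond the deadline the extended route waits on a self-loop, which is not a capacitated link.
    · simp only [h, dif_neg, not_false_eq_true, IsEmpty.exists_iff, iff_false]
      rintro rfl
      exact N.irrefl _ hl
  simp only [hiff]

/-- The expected scaled flow of schedules for random arrivals is feasible for the linear program. -/
theorem exists_feasible_of_schedules {S : Finset (J → ℕ → ℕ)} {w : (J → ℕ → ℕ) → ℝ}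
    (hw0 : ∀ A ∈ S, 0 ≤ w A) (hw1 : ∑ A ∈ S, w A ≤ 1) {lam : J → ℕ → ℝ}
    (hlam : ∀ j, ∀ s ∈ Finset.Icc 1 T, lam j s = ∑ A ∈ S, w A * A j s) {ε : ℝ} (hε : 0 < ε)
    {y : (J → ℕ → ℕ) → (j : J) → ℕ → ℕ → (Fin (N.deadline j + 1) → V × V) → ℕ}
    (hy : ∀ A ∈ S, N.RIFeasible T A (y A)) :
    ∃ g, N.FNSFeasible T lam ε g ∧
      (1 + ε) * N.fnsObjective T lam g = ∑ A ∈ S, w A * N.riObjective T A (y A) := by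
  have hε1 : 0 < 1 + ε := by linarith
  -- `H` is the expected number of packets sent over a link; the program asks for fractions of the
  -- arrivals, hence the later division by `lam j s`, with `1 + ε` providing the capacity margin.
  set H : J → V × V → ℕ → ℕ → ℝ := fun j l τ s =>
    ∑ A ∈ S, w A * N.scheduleFlow A (y A) j l τ s with hH
  have hH0 : ∀ j l τ s, 0 ≤ H j l τ s := fun j l τ s =>
    Finset.sum_nonneg fun A hA => mul_nonneg (hw0 A hA) (scheduleFlow_nonneg _ _ _ _ _ _)
  have hlam0 : ∀ j, ∀ s ∈ Finset.Icc 1 T, 0 ≤ lam j s := fun j s hs => by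
    rw [hlam j s hs]
    exact Finset.sum_nonneg fun A hA => mul_nonneg (hw0 A hA) (Nat.cast_nonneg _)
  have hHsum : ∀ j (F : Finset (V × V)) τ s, ∑ l ∈ F, H j l τ s
      = ∑ A ∈ S, w A * ∑ l ∈ F, N.scheduleFlow A (y A) j l τ s := fun j F τ s => by
    simp only [hH, Finset.mul_sum]
    exact Finset.sum_comm
  have hsrc : ∀ j, ∀ s ∈ Finset.Icc 1 T, ∑ l ∈ N.outLinks (N.src j), H j l 0 s ≤ lam j s := by
    intro j s hs
    rw [hHsum, hlam j s hs]
    exact Finset.sum_le_sum fun A hA =>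
      mul_le_mul_of_nonneg_left ((hy A hA).sum_scheduleFlow_source_le hs) (hw0 A hA)
  refine ⟨fun j l τ s => H j l τ s / ((1 + ε) * lam j s), ⟨?_, ?_, ?_, ?_, ?_, ?_⟩, ?_⟩
  · intro j s hs
    rw [← Finset.sum_div]
    refine div_le_one_of_le₀ ((hsrc j s hs).trans ?_) (mul_nonneg hε1.le (hlam0 j s hs))
    exact le_mul_of_one_le_left (hlam0 j s hs) (by linarith)
  · intro v τ hτ j s _
    obtain ⟨τ, rfl⟩ := Nat.exists_eq_add_of_le' (Finset.mem_Icc.1 hτ).1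
    rw [← Finset.sum_div, ← Finset.sum_div, hHsum, hHsum]
    simp only [Nat.add_sub_cancel, scheduleFlow_conservation]
  · intro j s _ l _ hl
    have : H j l 0 s = 0 := Finset.sum_eq_zero fun A _ => by
      rw [scheduleFlow, Finset.sum_eq_zero, mul_zero]
      refine fun n _ => Finset.sum_eq_zero fun k hk => if_neg ?_
      rw [extendRoute_zero]
      rintro rfl
      exact hl (mem_routes.1 hk).2.2.1
    rw [this, zero_div]
  · intro j s _ l _ hl
    have : H j l (N.deadline j) s = 0 := Finset.sum_eq_zero fun A _ => by
      rw [scheduleFlow, Finset.sum_eq_zero, mul_zero]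
      refine fun n _ => Finset.sum_eq_zero fun k hk => if_neg ?_
      rw [extendRoute_deadline]
      rintro rfl
      exact hl (mem_routes.1 hk).2.2.2
    rw [this, zero_div]
  · intro l hl t ht
    have h1 : ∀ s ∈ N.window T t, ∀ j ∈ Finset.univ,
        lam j s * (H j l (t - s) s / ((1 + ε) * lam j s)) ≤ H j l (t - s) s / (1 + ε) := by
      intro s _ j _
      -- With zero arrival rate the flow is a division by zero; the coefficient `lam j s` removes it
      -- here.
      by_cases h : lam j s = 0
      · rw [h, zero_mul]
        exact div_nonneg (hH0 _ _ _ _) hε1.le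
      · exact le_of_eq (by field_simp)
    refine (Finset.sum_le_sum fun s hs => Finset.sum_le_sum (h1 s hs)).trans ?_
    simp only [← Finset.sum_div]
    refine div_le_div_of_nonneg_right ?_ hε1.le
    have h2 : ∑ s ∈ N.window T t, ∑ j, H j l (t - s) s = ∑ A ∈ S, w A *
        ∑ s ∈ N.window T t, ∑ j, N.scheduleFlow A (y A) j l (t - s) s := by
      simp only [hH, Finset.mul_sum]
      rw [Finset.sum_congr rfl fun s _ => Finset.sum_comm]
      exact Finset.sum_comm
    rw [h2]
    calc ∑ A ∈ S, w A * ∑ s ∈ N.window T t, ∑ j, N.scheduleFlow A (y A) j l (t - s) s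
        ≤ ∑ A ∈ S, w A * N.cap l := Finset.sum_le_sum fun A hA =>
          mul_le_mul_of_nonneg_left ((hy A hA).scheduleFlow_capacity hl ht) (hw0 A hA)
      _ = (∑ A ∈ S, w A) * N.cap l := (Finset.sum_mul _ _ _).symm
      _ ≤ N.cap l := mul_le_of_le_one_left (Nat.cast_nonneg _) hw1
  · intro j l _ τ _ s hs
    exact div_nonneg (hH0 _ _ _ _) (mul_nonneg hε1.le (hlam0 j s hs))
  · have h3 : ∑ A ∈ S, w A * N.riObjective T A (y A)
        = ∑ s ∈ Finset.Icc 1 T, ∑ j, N.weight j * ∑ l ∈ N.outLinks (N.src j), H j l 0 s := by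
      simp only [hHsum, riObjective, sum_scheduleFlow_source]
      simp only [Finset.mul_sum (s := Finset.Icc 1 T), Finset.mul_sum (s := Finset.univ (α := J)),
        Finset.mul_sum (s := S)]
      rw [Finset.sum_comm]
      refine Finset.sum_congr rfl fun s _ => ?_
      rw [Finset.sum_comm]
      refine Finset.sum_congr rfl fun j _ => Finset.sum_congr rfl fun A _ => ?_
      ring
    rw [h3, fnsObjective, Finset.mul_sum]
    refine Finset.sum_congr rfl fun s hs => ?_
    rw [Finset.mul_sum]
    refine Finset.sum_congr rfl fun j _ => ?_
    rw [← Finset.sum_div]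
    by_cases h : lam j s = 0
    -- With zero arrival rate no packet is scheduled on average, so nothing is lost in the
    -- objective.
    · have : ∑ l ∈ N.outLinks (N.src j), H j l 0 s = 0 :=
        le_antisymm (h ▸ hsrc j s hs) (Finset.sum_nonneg fun l _ => hH0 _ _ _ _)
      rw [this, h]
      simp
    · field_simp

-- Near-optimal schedules suffice below, so the supremum need not be shown to be attained.
variable (N T A) in
theorem exists_feasible_of_lt_riValue {x : ℝ} (hx : x < N.riValue T A) :
    ∃ y, N.RIFeasible T A y ∧ x < N.riObjective T A y := by
  have hne : {x | ∃ y, N.RIFeasible T A y ∧ N.riObjective T A y = x}.Nonempty := by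
    refine ⟨_, fun _ _ _ _ => 0, ⟨?_, ?_, ?_⟩, rfl⟩ <;> intros <;> simp
  obtain ⟨_, ⟨y, hy, rfl⟩, h⟩ := exists_lt_of_lt_csSup hne hx
  exact ⟨y, hy, h⟩

theorem window_subset (t : ℕ) : N.window T t ⊆ Finset.Icc 1 T := fun s hs => by
  simp only [window, Finset.mem_Icc] at hs ⊢
  omega

theorem riValue_congr {A' : J → ℕ → ℕ} (h : ∀ j, ∀ s ∈ Finset.Icc 1 T, A j s = A' j s) :
    N.riValue T A = N.riValue T A' := by
  have hobj : ∀ y, N.riObjective T A y = N.riObjective T A' y := fun y =>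
    Finset.sum_congr rfl fun s hs => Finset.sum_congr rfl fun j _ => by rw [h j s hs]
  have hfeas : ∀ {A A' : J → ℕ → ℕ}, (∀ j, ∀ s ∈ Finset.Icc 1 T, A j s = A' j s) →
      ∀ y, N.RIFeasible T A y → N.RIFeasible T A' y := by
    intro A A' h y hy
    refine ⟨fun s hs j => ?_, fun l hl t ht => ?_, fun j s hs => ?_⟩
    · rw [← h j s hs]
      exact hy.one_choice s hs j
    · refine le_trans (le_of_eq ?_) (hy.capacity l hl t ht)
      refine Finset.sum_congr rfl fun s hs => Finset.sum_congr rfl fun j _ => ?_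
      rw [h j s (window_subset t hs)]
    · rw [← h j s hs]
      exact hy.binary j s hs
  simp only [riValue, hobj]
  congr 1
  ext x
  exact exists_congr fun y => and_congr_left fun _ =>
    ⟨hfeas h y, hfeas (fun j s hs => (h j s hs).symm) y⟩

end Network

/-! ### Generating functions of arrivals with bounded dependency degree -/

/-- The generating function of at most `D` independent trials is dominated by that of the extreme
distribution on `{0, D}` with the same mean. -/
theorem prod_one_add_pow_le {ι : Type*} [Fintype ι] {b : ι → ℕ} {D : ℕ} (hD : 1 ≤ D)
    (hb : ∑ s, b s ≤ D) {q : ι → ℝ} (hq0 : ∀ s, 0 ≤ q s) (hq1 : ∀ s, q s ≤ 1) {u : ℝ}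
    (hu : 0 ≤ u) :
    ∏ s, (1 + u * q s) ^ b s ≤ 1 + ((1 + u) ^ D - 1) / D * ∑ s, q s * b s := by
  have hD0 : (0 : ℝ) < D := by exact_mod_cast hD
  have hbD : (∑ s, (b s : ℝ)) ≤ D := by exact_mod_cast hb
  have hm : ∀ s, 0 ≤ 1 + u * q s := fun s => by have := mul_nonneg hu (hq0 s); linarith
  set p : ℝ := (∑ s, q s * b s) / D with hp
  have hp0 : 0 ≤ p := div_nonneg (Finset.sum_nonneg fun s _ => mul_nonneg (hq0 s) (Nat.cast_nonneg _))
    hD0.le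
  have hp1 : p ≤ 1 := by
    rw [hp, div_le_one hD0]
    refine le_trans (Finset.sum_le_sum fun s _ => ?_) hbD
    exact mul_le_of_le_one_left (Nat.cast_nonneg _) (hq1 s)
  -- The weights are `b s / D`; the missing weight is put on the value `1`, indexed by `none`.
  have hamgm := Real.geom_mean_le_arith_mean_weighted Finset.univ
    (fun o : Option ι => o.elim (1 - (∑ s, (b s : ℝ)) / D) fun s => (b s : ℝ) / D)
    (fun o : Option ι => o.elim 1 fun s => 1 + u * q s) ?_ ?_ ?_
  · simp only [Fintype.prod_option, Fintype.sum_option, Option.elim, Real.one_rpow, one_mul,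
      mul_one] at hamgm
    have hmean : 1 - (∑ s, (b s : ℝ)) / D + ∑ s, (b s : ℝ) / D * (1 + u * q s) = 1 + u * p := by
      rw [hp, Finset.sum_div, Finset.sum_div, Finset.mul_sum, sub_add, ← Finset.sum_sub_distrib,
        sub_eq_add_neg, ← Finset.sum_neg_distrib]
      congr 1
      refine Finset.sum_congr rfl fun s _ => ?_
      ring
    rw [hmean] at hamgm
    have hpow := pow_le_pow_left₀ (Finset.prod_nonneg fun s _ => Real.rpow_nonneg (hm s) _) hamgm D
    rw [← Finset.prod_pow] at hpow
    -- Convexity of `x ^ D` on the segment from `1` to `1 + u`: the chord is the generating function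
    -- of the law on `{0, D}`.
    have hconv : (1 + u * p) ^ D ≤ 1 + p * ((1 + u) ^ D - 1) := by
      have h := (convexOn_pow D).2 (x := 1 + u) (y := 1) (Set.mem_Ici.2 (by linarith))
        (Set.mem_Ici.2 zero_le_one) hp0 (sub_nonneg.2 hp1) (by ring)
      simp only [smul_eq_mul, one_pow, mul_one] at h
      refine le_trans (le_of_eq ?_) (h.trans (le_of_eq ?_)) <;> ring
    calc ∏ s, (1 + u * q s) ^ b s = ∏ s, ((1 + u * q s) ^ ((b s : ℝ) / D)) ^ D := by
          refine Finset.prod_congr rfl fun s _ => ?_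
          rw [← Real.rpow_natCast, ← Real.rpow_natCast, ← Real.rpow_mul (hm s),
            div_mul_cancel₀ _ hD0.ne']
      _ ≤ (1 + u * p) ^ D := hpow
      _ ≤ _ := hconv
      _ = _ := by rw [hp]; ring
  · rintro (_ | s) _
    · simpa using (div_le_one hD0).2 hbD
    · simp only [Option.elim]
      positivity
  · simp only [Fintype.sum_option, Option.elim]
    rw [← Finset.sum_div]
    ring
  · rintro (_ | s) _
    · simp
    · exact hm s

/-- One packet in slot `s₀` keeps its own factor; each of its at most `D - 1` group mates is bounded
by the worst case `1 + u`. -/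
theorem prod_one_add_pow_le_of_pos {ι : Type*} [Fintype ι] [DecidableEq ι] {b : ι → ℕ} {D : ℕ}
    (hb : ∑ s, b s ≤ D) {q : ι → ℝ} (hq0 : ∀ s, 0 ≤ q s) (hq1 : ∀ s, q s ≤ 1) {u : ℝ}
    (hu : 0 ≤ u) {s₀ : ι} (hs : 0 < b s₀) :
    ∏ s, (1 + u * q s) ^ b s ≤ (1 + u * q s₀) * (1 + u) ^ (D - 1) := by
  have hm : ∀ s, 0 ≤ 1 + u * q s := fun s => by have := mul_nonneg hu (hq0 s); linarith
  have hmu : ∀ s, 1 + u * q s ≤ 1 + u := fun s => by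
    have := mul_le_of_le_one_right hu (hq1 s); linarith
  rw [← Finset.mul_prod_erase _ _ (Finset.mem_univ s₀)]
  rw [← Finset.add_sum_erase _ _ (Finset.mem_univ s₀)] at hb
  obtain ⟨k, hk⟩ := Nat.exists_eq_add_of_le' hs
  rw [hk, pow_succ', mul_assoc]
  refine mul_le_mul_of_nonneg_left ?_ (hm s₀)
  calc (1 + u * q s₀) ^ k * ∏ s ∈ Finset.univ.erase s₀, (1 + u * q s) ^ b s
      ≤ (1 + u) ^ k * ∏ s ∈ Finset.univ.erase s₀, (1 + u) ^ b s := by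
        refine mul_le_mul (pow_le_pow_left₀ (hm _) (hmu _) _)
          (Finset.prod_le_prod (fun s _ => pow_nonneg (hm s) _)
            fun s _ => pow_le_pow_left₀ (hm s) (hmu s) _)
          (Finset.prod_nonneg fun s _ => pow_nonneg (hm s) _) (by positivity)
    _ = (1 + u) ^ (k + ∑ s ∈ Finset.univ.erase s₀, b s) := by
        rw [Finset.prod_pow_eq_pow_sum, pow_add]
    _ ≤ (1 + u) ^ (D - 1) := pow_le_pow_right₀ (by linarith) (by omega)

section Group

variable {ι : Type*} [Fintype ι] [DecidableEq ι] {ρ : Measure (ι → ℕ)} [IsProbabilityMeasure ρ]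
  {D : ℕ}

theorem integrable_of_ae_sum_le (h : ∀ᵐ b ∂ρ, ∑ s, b s ≤ D) {φ : (ι → ℕ) → ℝ} {C : ℝ}
    (hφ : ∀ b : ι → ℕ, ∑ s, b s ≤ D → ‖φ b‖ ≤ C) : Integrable φ ρ :=
  Integrable.of_bound Measurable.of_discrete.aestronglyMeasurable C (h.mono hφ)

theorem le_of_sum_le {b : ι → ℕ} (h : ∑ s, b s ≤ D) (s : ι) : b s ≤ D :=
  (Finset.single_le_sum (f := b) (fun _ _ => Nat.zero_le _) (Finset.mem_univ s)).trans h

theorem integrable_eval_of_ae_sum_le (h : ∀ᵐ b ∂ρ, ∑ s, b s ≤ D) (s : ι) :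
    Integrable (fun b : ι → ℕ => (b s : ℝ)) ρ := by
  refine integrable_of_ae_sum_le h (C := D) fun b hb => ?_
  rw [Real.norm_of_nonneg (Nat.cast_nonneg _)]
  exact_mod_cast le_of_sum_le hb s

variable {q : ι → ℝ} {u : ℝ}

theorem norm_prod_one_add_pow_le {b : ι → ℕ} (hb : ∑ s, b s ≤ D) (hq0 : ∀ s, 0 ≤ q s)
    (hq1 : ∀ s, q s ≤ 1) (hu : 0 ≤ u) : ‖∏ s, (1 + u * q s) ^ b s‖ ≤ (1 + u) ^ D := by
  have hm : ∀ s, 0 ≤ 1 + u * q s := fun s => by have := mul_nonneg hu (hq0 s); linarith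
  have hmu : ∀ s, 1 + u * q s ≤ 1 + u := fun s => by
    have := mul_le_of_le_one_right hu (hq1 s); linarith
  rw [Real.norm_of_nonneg (Finset.prod_nonneg fun s _ => pow_nonneg (hm s) _)]
  calc ∏ s, (1 + u * q s) ^ b s ≤ ∏ s, (1 + u) ^ b s :=
        Finset.prod_le_prod (fun s _ => pow_nonneg (hm s) _)
          fun s _ => pow_le_pow_left₀ (hm s) (hmu s) _
    _ = (1 + u) ^ ∑ s, b s := Finset.prod_pow_eq_pow_sum _ _ _
    _ ≤ _ := pow_le_pow_right₀ (by linarith) hb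

theorem integrable_prod_one_add_pow (h : ∀ᵐ b ∂ρ, ∑ s, b s ≤ D) (hq0 : ∀ s, 0 ≤ q s)
    (hq1 : ∀ s, q s ≤ 1) (hu : 0 ≤ u) : Integrable (fun b => ∏ s, (1 + u * q s) ^ b s) ρ :=
  integrable_of_ae_sum_le h fun _ hb => norm_prod_one_add_pow_le hb hq0 hq1 hu

theorem integral_prod_one_add_pow_le_exp (hD : 1 ≤ D) (h : ∀ᵐ b ∂ρ, ∑ s, b s ≤ D)
    (hq0 : ∀ s, 0 ≤ q s) (hq1 : ∀ s, q s ≤ 1) (hu : 0 ≤ u) :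
    ∫ b, ∏ s, (1 + u * q s) ^ b s ∂ρ
      ≤ Real.exp (((1 + u) ^ D - 1) / D * ∑ s, q s * ∫ b, (b s : ℝ) ∂ρ) := by
  have hint : ∀ s ∈ Finset.univ, Integrable (fun b : ι → ℕ => q s * (b s : ℝ)) ρ :=
    fun s _ => (integrable_eval_of_ae_sum_le h s).const_mul _
  calc ∫ b, ∏ s, (1 + u * q s) ^ b s ∂ρ
      ≤ ∫ b : ι → ℕ, 1 + ((1 + u) ^ D - 1) / D * ∑ s, q s * (b s : ℝ) ∂ρ :=
        integral_mono_ae (integrable_prod_one_add_pow h hq0 hq1 hu)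
          ((integrable_const _).add ((integrable_finsetSum _ hint).const_mul _))
          (h.mono fun b hb => prod_one_add_pow_le hD hb hq0 hq1 hu)
    _ = ((1 + u) ^ D - 1) / D * ∑ s, q s * ∫ b, (b s : ℝ) ∂ρ + 1 := by
        rw [integral_add (integrable_const _) ((integrable_finsetSum _ hint).const_mul _),
          integral_const_mul, integral_finsetSum _ hint]
        simp [integral_const_mul, add_comm]
    _ ≤ _ := Real.add_one_le_exp _

/-- The weight `b s₀` marks a packet of the group; the pointwise bound applies whenever it is
nonzero. -/
theorem integral_eval_mul_prod_le (h : ∀ᵐ b ∂ρ, ∑ s, b s ≤ D) (hq0 : ∀ s, 0 ≤ q s)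
    (hq1 : ∀ s, q s ≤ 1) (hu : 0 ≤ u) (s₀ : ι) :
    ∫ b : ι → ℕ, b s₀ * ∏ s, (1 + u * q s) ^ b s ∂ρ
      ≤ (1 + u * q s₀) * (1 + u) ^ (D - 1) * ∫ b, (b s₀ : ℝ) ∂ρ := by
  rw [← integral_const_mul]
  refine integral_mono_ae (integrable_of_ae_sum_le h (C := D * (1 + u) ^ D) fun b hb => ?_)
    ((integrable_eval_of_ae_sum_le h s₀).const_mul _) (h.mono fun b hb => ?_)
  · rw [norm_mul, Real.norm_of_nonneg (Nat.cast_nonneg _)]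
    exact mul_le_mul (by exact_mod_cast le_of_sum_le hb s₀)
      (norm_prod_one_add_pow_le hb hq0 hq1 hu) (norm_nonneg _) (Nat.cast_nonneg _)
  · rcases Nat.eq_zero_or_pos (b s₀) with h0 | h0
    · simp [h0]
    · simp only
      rw [mul_comm]
      exact mul_le_mul_of_nonneg_right (prod_one_add_pow_le_of_pos hb hq0 hq1 hu h0)
        (Nat.cast_nonneg _)

end Group

theorem IsDecomposable.mono {ι : Type*} [Fintype ι] {ν : Measure (ι → ℕ)} {D D' : ℕ}
    (h : IsDecomposable ν D) (hD : D ≤ D') : IsDecomposable ν D' := by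
  obtain ⟨n, ρ, h1, h2, h3⟩ := h
  exact ⟨n, ρ, h1, fun i => (h2 i).mono fun b hb => hb.trans hD, h3⟩

/-- The infimum is over natural numbers: if `D` failed, so would every smaller bound, and the
infimum would be at least `D + 1`. -/
theorem isDecomposable_of_dependencyDegree_le {ι : Type*} [Fintype ι] {ν : Measure (ι → ℕ)} {D : ℕ}
    (h : dependencyDegree ν ≤ D) : IsDecomposable ν D := by
  by_contra hcon
  have h1 : ((D + 1 : ℕ) : ℕ∞) ≤ dependencyDegree ν := by
    refine le_iInf₂ fun D' hD' => ?_
    rw [Nat.cast_le]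
    by_contra hlt
    exact hcon (hD'.mono (by omega))
  have h2 := h1.trans h
  rw [Nat.cast_le] at h2
  omega

section Decomposable

variable {ι : Type*} [Fintype ι] [DecidableEq ι] {ν : Measure (ι → ℕ)} {D : ℕ}

theorem IsDecomposable.ae_le (h : IsDecomposable ν D) :
    ∃ n : ℕ, ∀ᵐ x ∂ν, ∀ s, x s ≤ n * D := by
  obtain ⟨n, ρ, h1, h2, rfl⟩ := h
  refine ⟨n, ?_⟩
  rw [ae_map_iff Measurable.of_discrete.aemeasurable (Set.to_countable _).measurableSet]
  have : ∀ᵐ b ∂Measure.pi ρ, ∀ i, ∑ s, b i s ≤ D := by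
    rw [ae_all_iff]
    exact fun i => (Measure.quasiMeasurePreserving_eval ρ i).ae (h2 i)
  filter_upwards [this] with b hb s
  calc ∑ i, b i s ≤ ∑ _i : Fin n, D := Finset.sum_le_sum fun i _ => le_of_sum_le (hb i) s
    _ = n * D := by simp

variable {q : ι → ℝ} {u : ℝ}

/-- Independence multiplies the bounds of the groups, so the exponents add up to the total mean. For
the second bound, the marked packet is attributed to its group, and the contributions are summed
over the groups. -/
theorem IsDecomposable.integral_le (hD : 1 ≤ D) (h : IsDecomposable ν D)
    (hq0 : ∀ s, 0 ≤ q s) (hq1 : ∀ s, q s ≤ 1) (hu : 0 ≤ u) :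
    ∫ x, ∏ s, (1 + u * q s) ^ x s ∂ν
        ≤ Real.exp (((1 + u) ^ D - 1) / D * ∑ s, q s * ∫ x, (x s : ℝ) ∂ν) ∧
    ∀ s₀, ∫ x : ι → ℕ, x s₀ * ∏ s, (1 + u * q s) ^ x s ∂ν
        ≤ (1 + u * q s₀) * (1 + u) ^ (D - 1) * (∫ x, (x s₀ : ℝ) ∂ν) *
          Real.exp (((1 + u) ^ D - 1) / D * ∑ s, q s * ∫ x, (x s : ℝ) ∂ν) := by
  obtain ⟨n, ρ, hρ, hb, rfl⟩ := h
  set e : ℝ := ((1 + u) ^ D - 1) / D with he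
  have he0 : 0 ≤ e := div_nonneg (sub_nonneg.2 (one_le_pow₀ (by linarith))) (Nat.cast_nonneg _)
  have hm : ∀ s, 0 ≤ 1 + u * q s := fun s => by have := mul_nonneg hu (hq0 s); linarith
  set φ : (ι → ℕ) → ℝ := fun b => ∏ s, (1 + u * q s) ^ b s with hφ
  have hφ0 : ∀ b, 0 ≤ φ b := fun b => Finset.prod_nonneg fun s _ => pow_nonneg (hm s) _
  set κ : Fin n → ℝ := fun i => e * ∑ s, q s * ∫ b, (b s : ℝ) ∂(ρ i) with hκ
  have hκ0 : ∀ i, 0 ≤ κ i := fun i => mul_nonneg he0 (Finset.sum_nonneg fun s _ =>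
    mul_nonneg (hq0 s) (integral_nonneg fun b => Nat.cast_nonneg _))
  have hmap : ∀ F : (ι → ℕ) → ℝ, ∫ x, F x ∂((Measure.pi ρ).map fun b s => ∑ i, b i s)
      = ∫ b, F (fun s => ∑ i, b i s) ∂Measure.pi ρ := fun F =>
    integral_map Measurable.of_discrete.aemeasurable Measurable.of_discrete.aestronglyMeasurable
  have hfac : ∀ b : Fin n → ι → ℕ, ∏ s, (1 + u * q s) ^ ∑ i, b i s = ∏ i, φ (b i) := fun b => by
    simp only [hφ, ← Finset.prod_pow_eq_pow_sum]
    exact Finset.prod_comm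
  have hint : ∀ i s, Integrable (fun b : Fin n → ι → ℕ => (b i s : ℝ)) (Measure.pi ρ) := by
    intro i s
    exact (measurePreserving_eval ρ i).integrable_comp_of_integrable
      (integrable_eval_of_ae_sum_le (hb i) s)
  have hmean : ∀ s, ∫ x, (x s : ℝ) ∂((Measure.pi ρ).map fun b s => ∑ i, b i s)
      = ∑ i, ∫ b, (b s : ℝ) ∂(ρ i) := by
    intro s
    rw [hmap]
    simp only [Nat.cast_sum]
    rw [integral_finsetSum _ fun i _ => hint i s]
    refine Finset.sum_congr rfl fun i _ => ?_
    rw [← (measurePreserving_eval ρ i).map_eq, integral_map (measurable_pi_apply i).aemeasurable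
      Measurable.of_discrete.aestronglyMeasurable]
  have hκsum : e * ∑ s, q s * ∫ x, (x s : ℝ) ∂((Measure.pi ρ).map fun b s => ∑ i, b i s)
      = ∑ i, κ i := by
    simp only [hmean, hκ, Finset.mul_sum]
    exact Finset.sum_comm
  have hone : ∀ i, ∫ b, φ b ∂(ρ i) ≤ Real.exp (κ i) := fun i =>
    integral_prod_one_add_pow_le_exp hD (hb i) hq0 hq1 hu
  rw [hκsum, Real.exp_sum]
  refine ⟨?_, fun s₀ => ?_⟩
  · rw [hmap]
    simp only [hfac]
    rw [integral_fintype_prod_eq_prod (f := fun _ => φ)]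
    exact Finset.prod_le_prod (fun i _ => integral_nonneg hφ0) fun i _ => hone i
  · rw [hmap, hmean]
    simp only [hfac, Nat.cast_sum, Finset.sum_mul]
    have hterm : ∀ (i : Fin n) (b : Fin n → ι → ℕ), (b i s₀ : ℝ) * ∏ i', φ (b i')
        = ∏ i', (if i' = i then fun b : ι → ℕ => (b s₀ : ℝ) * φ b else φ) (b i') := by
      intro i b
      rw [← Finset.mul_prod_erase _ _ (Finset.mem_univ i),
        ← Finset.mul_prod_erase _ (fun i' => (if i' = i then fun b : ι → ℕ => (b s₀ : ℝ) * φ b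
          else φ) (b i')) (Finset.mem_univ i), if_pos rfl, mul_assoc]
      congr 2
      refine Finset.prod_congr rfl fun i' hi' => ?_
      rw [if_neg (Finset.ne_of_mem_erase hi')]
    have hbound : ∀ b : Fin n → ι → ℕ, (∀ i, ∑ s, b i s ≤ D) → ∀ i,
        ‖(b i s₀ : ℝ) * ∏ i', φ (b i')‖ ≤ D * ∏ _i' : Fin n, (1 + u) ^ D := by
      intro b hbD i
      rw [norm_mul, Real.norm_of_nonneg (Nat.cast_nonneg _), norm_prod]
      exact mul_le_mul (by exact_mod_cast le_of_sum_le (hbD i) s₀)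
        (Finset.prod_le_prod (fun i _ => norm_nonneg _)
          fun i _ => norm_prod_one_add_pow_le (hbD i) hq0 hq1 hu)
        (Finset.prod_nonneg fun i _ => norm_nonneg _) (Nat.cast_nonneg _)
    have hbD : ∀ᵐ b ∂Measure.pi ρ, ∀ i, ∑ s, b i s ≤ D := by
      rw [ae_all_iff]
      exact fun i => (Measure.quasiMeasurePreserving_eval ρ i).ae (hb i)
    rw [integral_finsetSum _ fun i _ => Integrable.of_bound
      Measurable.of_discrete.aestronglyMeasurable _ (hbD.mono fun b h => hbound b h i),
      Finset.mul_sum, Finset.sum_mul]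
    refine Finset.sum_le_sum fun i _ => ?_
    simp only [hterm]
    rw [integral_fintype_prod_eq_prod (f := fun i' => if i' = i
      then fun b : ι → ℕ => (b s₀ : ℝ) * φ b else φ), ← Finset.mul_prod_erase _ _
      (Finset.mem_univ i), if_pos rfl]
    refine mul_le_mul (integral_eval_mul_prod_le (hb i) hq0 hq1 hu s₀) ?_
      (Finset.prod_nonneg fun i' hi' => ?_) (mul_nonneg (mul_nonneg (hm s₀) (by positivity))
        (integral_nonneg fun b => Nat.cast_nonneg _))
    -- The marked group supplies no exponential factor; `exp (κ i) ≥ 1` is inserted to complete the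
    -- product.
    · rw [← Finset.mul_prod_erase _ _ (Finset.mem_univ i)]
      refine le_trans (Finset.prod_le_prod (fun i' hi' => ?_) fun i' hi' => ?_)
        (le_mul_of_one_le_left (Finset.prod_nonneg fun i' _ => (Real.exp_pos (κ i')).le)
          (Real.one_le_exp (hκ0 i)))
      · rw [if_neg (Finset.ne_of_mem_erase hi')]
        exact integral_nonneg hφ0
      · rw [if_neg (Finset.ne_of_mem_erase hi')]
        exact hone i'
    · rw [if_neg (Finset.ne_of_mem_erase hi')]
      exact integral_nonneg hφ0

end Decomposable

/-- The moments of the superposition of independent decomposable processes. -/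
theorem integral_mul_prod_prod_le {J Ω : Type*} [Fintype J] [DecidableEq J] [MeasurableSpace Ω]
    {μ : Measure Ω} {a : J → ℕ → Ω → ℕ} (ha : ∀ j t, Measurable (a j t))
    (hindep : iIndepFun (fun j ω t => a j t ω) μ) {D : ℕ} (hD : 1 ≤ D) {W : Finset ℕ}
    (h : ∀ j, IsDecomposable (μ.map fun ω (s : W) => a j s ω) D)
    {q : J → ℕ → ℝ} (hq0 : ∀ j, ∀ s ∈ W, 0 ≤ q j s) (hq1 : ∀ j, ∀ s ∈ W, q j s ≤ 1)
    {u : ℝ} (hu : 0 ≤ u) (j₀ : J) {s₀ : ℕ} (hs₀ : s₀ ∈ W) :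
    ∫ ω, a j₀ s₀ ω * ∏ j, ∏ s ∈ W, (1 + u * q j s) ^ a j s ω ∂μ
      ≤ (1 + u * q j₀ s₀) * (1 + u) ^ (D - 1) * (∫ ω, (a j₀ s₀ ω : ℝ) ∂μ) *
        Real.exp (((1 + u) ^ D - 1) / D * ∑ s ∈ W, ∑ j, (∫ ω, (a j s ω : ℝ) ∂μ) * q j s) := by
  have ham : ∀ j, AEMeasurable (fun ω (s : W) => a j s ω) μ := fun j =>
    (measurable_pi_lambda (fun ω (s : W) => a j s ω) fun s => ha j s).aemeasurable
  have hmap : ∀ j, ∀ F : (W → ℕ) → ℝ, ∫ x, F x ∂(μ.map fun ω (s : W) => a j s ω)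
      = ∫ ω, F (fun s => a j s ω) ∂μ := fun j F =>
    integral_map (ham j) Measurable.of_discrete.aestronglyMeasurable
  set φ : J → (W → ℕ) → ℝ := fun j b => ∏ s : W, (1 + u * q j s) ^ b s with hφ
  have hφ0 : ∀ j b, 0 ≤ φ j b := fun j b => Finset.prod_nonneg fun s _ => pow_nonneg
    (by have := mul_nonneg hu (hq0 j s s.2); linarith) _
  set κ : J → ℝ := fun j => ((1 + u) ^ D - 1) / D * ∑ s : W, q j s * ∫ ω, (a j s ω : ℝ) ∂μ with hκ
  have hκsum : ((1 + u) ^ D - 1) / D * ∑ s ∈ W, ∑ j, (∫ ω, (a j s ω : ℝ) ∂μ) * q j s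
      = ∑ j, κ j := by
    rw [hκ, ← Finset.mul_sum, Finset.sum_comm]
    congr 1
    refine Finset.sum_congr rfl fun j _ => ?_
    rw [← Finset.sum_coe_sort W fun s => (∫ ω, (a j s ω : ℝ) ∂μ) * q j s]
    exact Finset.sum_congr rfl fun s _ => mul_comm _ _
  have h1 : ∀ j, ∫ ω, φ j (fun s => a j s ω) ∂μ ≤ Real.exp (κ j) := by
    intro j
    have := ((h j).integral_le hD (q := fun s : W => q j s) (fun s => hq0 j s s.2)
      (fun s => hq1 j s s.2) hu).1
    rw [hmap] at this
    simpa only [hmap j fun x => (x _ : ℝ)] using this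
  have h2 : ∫ ω, (a j₀ s₀ ω : ℝ) * φ j₀ (fun s => a j₀ s ω) ∂μ
      ≤ (1 + u * q j₀ s₀) * (1 + u) ^ (D - 1) * (∫ ω, (a j₀ s₀ ω : ℝ) ∂μ) * Real.exp (κ j₀) := by
    have := ((h j₀).integral_le hD (q := fun s : W => q j₀ s) (fun s => hq0 j₀ s s.2)
      (fun s => hq1 j₀ s s.2) hu).2 ⟨s₀, hs₀⟩
    rw [hmap] at this
    simpa only [hmap j₀ fun x => (x _ : ℝ)] using this
  -- The marking factor is absorbed into type `j₀`, so that the integrand is a product over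
  -- independent types.
  set G : J → (ℕ → ℕ) → ℝ := fun j x =>
    if j = j₀ then (x s₀ : ℝ) * φ j (fun s => x s) else φ j (fun s => x s) with hG
  have hGm : ∀ j, Measurable (G j) := by
    intro j
    have hr : Measurable fun x : ℕ → ℕ => φ j (fun s => x s) :=
      (Measurable.of_discrete (f := φ j)).comp
        (measurable_pi_lambda (fun (x : ℕ → ℕ) (s : W) => x s) fun s => measurable_pi_apply _)
    simp only [hG]
    split_ifs
    · exact ((Measurable.of_discrete (f := fun n : ℕ => (n : ℝ))).comp (measurable_pi_apply s₀)).mul hr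
    · exact hr
  have hterm : ∀ ω, (a j₀ s₀ ω : ℝ) * ∏ j, ∏ s ∈ W, (1 + u * q j s) ^ a j s ω
      = ∏ j, G j (fun t => a j t ω) := by
    intro ω
    have hφW : ∀ j, ∏ s ∈ W, (1 + u * q j s) ^ a j s ω = φ j (fun s => a j s ω) := fun j =>
      (Finset.prod_coe_sort W fun s => (1 + u * q j s) ^ a j s ω).symm
    simp only [hφW]
    rw [← Finset.mul_prod_erase _ _ (Finset.mem_univ j₀),
      ← Finset.mul_prod_erase _ (fun j => G j fun t => a j t ω) (Finset.mem_univ j₀), ← mul_assoc]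
    congr 1
    · simp [hG]
    · exact Finset.prod_congr rfl fun j hj => by simp [hG, Finset.ne_of_mem_erase hj]
  simp only [hterm]
  rw [hκsum, Real.exp_sum, iIndepFun.integral_fun_prod_comp hindep
    (fun j => (measurable_pi_lambda _ fun t => ha j t).aemeasurable)
    fun j => (hGm j).aestronglyMeasurable, ← Finset.mul_prod_erase _ _ (Finset.mem_univ j₀),
    ← Finset.mul_prod_erase _ _ (Finset.mem_univ j₀), ← mul_assoc]
  refine mul_le_mul ?_ (Finset.prod_le_prod (fun j hj => ?_) fun j hj => ?_)
    (Finset.prod_nonneg fun j hj => ?_) (mul_nonneg (mul_nonneg (mul_nonneg ?_ (by positivity))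
      (integral_nonneg fun b => Nat.cast_nonneg _)) (Real.exp_pos _).le)
  · simpa only [hG, if_true] using h2
  · simp only [hG, if_neg (Finset.ne_of_mem_erase hj)]
    exact integral_nonneg fun ω => hφ0 j _
  · simp only [hG, if_neg (Finset.ne_of_mem_erase hj)]
    exact h1 j
  · simp only [hG, if_neg (Finset.ne_of_mem_erase hj)]
    exact integral_nonneg fun ω => hφ0 j _
  · have := mul_nonneg hu (hq0 j₀ s₀ hs₀)
    linarith

/-! ### Averaging over finitely many arrival patterns -/

section FiniteRange

variable {Ω β : Type*} [MeasurableSpace Ω] {μ : Measure Ω} [MeasurableSpace β]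
  [MeasurableSingletonClass β] {K : Ω → β} {S : Finset β}

theorem comp_ae_eq_sum_indicator (hS : ∀ᵐ ω ∂μ, K ω ∈ S) (F : β → Ω → ℝ) :
    (fun ω => F (K ω) ω) =ᵐ[μ] fun ω => ∑ A ∈ S, (K ⁻¹' {A}).indicator (F A) ω := by
  classical
  filter_upwards [hS] with ω hω
  rw [Finset.sum_eq_single (K ω)]
  · rw [Set.indicator_of_mem (by simp)]
  · intro A _ hA
    exact Set.indicator_of_notMem (s := K ⁻¹' {A}) (fun h => hA (Eq.symm h)) _
  · exact fun h => absurd hω h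

theorem integrable_comp_of_finite_range (hK : Measurable K) (hS : ∀ᵐ ω ∂μ, K ω ∈ S)
    {F : β → Ω → ℝ} (hF : ∀ A ∈ S, Integrable (F A) μ) : Integrable (fun ω => F (K ω) ω) μ :=
  (integrable_finsetSum _ fun A hA => (hF A hA).indicator (hK (measurableSet_singleton A))).congr
    (comp_ae_eq_sum_indicator hS F).symm

theorem integral_comp_of_finite_range [IsFiniteMeasure μ] (hK : Measurable K)
    (hS : ∀ᵐ ω ∂μ, K ω ∈ S) (φ : β → ℝ) :
    ∫ ω, φ (K ω) ∂μ = ∑ A ∈ S, μ.real (K ⁻¹' {A}) * φ A := by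
  rw [integral_congr_ae (comp_ae_eq_sum_indicator hS fun A _ => φ A), integral_finsetSum]
  · refine Finset.sum_congr rfl fun A _ => ?_
    rw [integral_indicator_const _ (hK (measurableSet_singleton A)), smul_eq_mul]
  · exact fun A _ => (integrable_const _).indicator (hK (measurableSet_singleton A))

/-- This is conditioning on `K`: with finitely many values it becomes a finite sum, and by
independence `K` may be frozen inside each integral. -/
theorem integral_comp_of_finite_range_of_indep {γ : Type*} [MeasurableSpace γ] {Y : Ω → γ}
    [IsFiniteMeasure μ] (hK : Measurable K) (hY : Measurable Y) (hKY : IndepFun K Y μ)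
    (hS : ∀ᵐ ω ∂μ, K ω ∈ S) {G : β → γ → ℝ} (hG : ∀ A ∈ S, Measurable (G A))
    (hGi : ∀ A ∈ S, Integrable (fun ω => G A (Y ω)) μ) :
    ∫ ω, G (K ω) (Y ω) ∂μ = ∑ A ∈ S, μ.real (K ⁻¹' {A}) * ∫ ω, G A (Y ω) ∂μ := by
  rw [integral_congr_ae (comp_ae_eq_sum_indicator hS fun A ω => G A (Y ω)), integral_finsetSum]
  · refine Finset.sum_congr rfl fun A hA => ?_
    have hind : IndepFun (fun ω => (K ⁻¹' {A}).indicator (fun _ => (1 : ℝ)) ω)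
        (fun ω => G A (Y ω)) μ :=
      hKY.comp (φ := fun b => Set.indicator {A} (fun _ => (1 : ℝ)) b) (ψ := G A)
        (measurable_const.indicator (measurableSet_singleton A)) (hG A hA)
    have h1 := hind.integral_fun_mul_eq_mul_integral
      (measurable_const.indicator (hK (measurableSet_singleton A))).aestronglyMeasurable
      ((hG A hA).comp hY).aestronglyMeasurable
    rw [integral_indicator_const _ (hK (measurableSet_singleton A)), smul_eq_mul, mul_one] at h1
    rw [← h1]
    refine integral_congr_ae (Filter.Eventually.of_forall fun ω => ?_)
    by_cases h : ω ∈ K ⁻¹' {A} <;> simp [h]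
  · exact fun A hA => (hGi A hA).indicator (hK (measurableSet_singleton A))

end FiniteRange

/-- The arrivals during `1, …, T`. -/
def truncate {J : Type*} (T : ℕ) (A : J → ℕ → ℕ) : J → ℕ → ℕ :=
  fun j s => if s ∈ Finset.Icc 1 T then A j s else 0

theorem truncate_apply {J : Type*} {T : ℕ} (A : J → ℕ → ℕ) (j : J) {s : ℕ}
    (hs : s ∈ Finset.Icc 1 T) : truncate T A j s = A j s :=
  if_pos hs

theorem measurable_truncate {J : Type*} (T : ℕ) :
    Measurable (truncate T : (J → ℕ → ℕ) → J → ℕ → ℕ) := by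
  refine measurable_pi_lambda _ fun j => measurable_pi_lambda _ fun s => ?_
  unfold truncate
  split_ifs
  · exact (measurable_pi_apply s).comp (measurable_pi_apply j)
  · exact measurable_const

/-- Arrivals outside `1, …, T` are unrestricted, so only after truncation does a bound leave
finitely many patterns. -/
theorem exists_finset_truncate_mem {J : Type*} [Fintype J] [DecidableEq J] (T M : ℕ) :
    ∃ S : Finset (J → ℕ → ℕ), ∀ A : J → ℕ → ℕ, (∀ j, ∀ s ∈ Finset.Icc 1 T, A j s ≤ M) →
      truncate T A ∈ S := by
  classical
  refine ⟨(Fintype.piFinset fun _ : J => Fintype.piFinset fun _ : Finset.Icc 1 T =>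
    Finset.range (M + 1)).image fun B j s => if h : s ∈ Finset.Icc 1 T then B j ⟨s, h⟩ else 0,
    fun A hA => Finset.mem_image.2 ⟨fun j s => A j s, ?_, ?_⟩⟩
  · simp only [Fintype.mem_piFinset, Finset.mem_range]
    exact fun j s => Nat.lt_succ_of_le (hA j s s.2)
  · funext j s
    simp [truncate]

/-! ### Integrability of the rewards and the bound on the benchmark -/

namespace Network

variable {V J : Type*} [Fintype V] [DecidableEq V] [Fintype J] [DecidableEq J] {N : Network V J}
  {Ω : Type*} [MeasurableSpace Ω] {μ : Measure Ω}

theorem measurableSet_location (T : ℕ) (A : J → ℕ → ℕ) {c : Packet J → ℕ → V → Ω → Choice V}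
    (hc : ∀ p τ v, Measurable (c p τ v)) {r : ℕ → Packet J → Ω → ℕ}
    (hr : ∀ t p, Measurable (r t p)) (t : ℕ) (p : Packet J) (w : V) :
    MeasurableSet {ω | N.location T A (fun p τ v => c p τ v ω) (fun t p => r t p ω) t p
      = some w} := by
  classical
  induction t generalizing p w with
  | zero => simp [location]
  | succ t ih =>
    by_cases hp : p ∈ arrivedPackets T A ∧ p.2.1 = t + 1
    · simp only [location_succ, if_pos hp]
      exact MeasurableSet.const _
    have hsel : ∀ q l, MeasurableSet {ω | N.selected (fun p τ v => c p τ v ω) t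
        (N.location T A (fun p τ v => c p τ v ω) (fun t p => r t p ω) t) q = Choice.take l} := by
      intro q l
      simp only [selected_eq_take, Set.ofPred_exists, Set.ofPred_and]
      exact MeasurableSet.iUnion fun v => (ih q v).inter ((MeasurableSet.const _).inter
        (Choice.measurableSet_setOf_eq (hc _ _ _) fun x => x = Choice.take l))
    have hnum : ∀ l, Measurable fun ω => N.numBefore T A (fun p τ v => c p τ v ω)
        (fun p => r t p ω) t
        (N.location T A (fun p τ v => c p τ v ω) (fun t p => r t p ω) t) p l := by
      intro l
      simp only [numBefore, Finset.card_filter]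
      refine Finset.measurable_sum _ fun q _ => Measurable.ite ?_ measurable_const measurable_const
      exact (hsel q l).inter (measurableSet_lt (hr t q) (hr t p))
    simp only [location_succ_eq_some _ _ _ _ _ hp, Set.ofPred_exists, Set.ofPred_and]
    exact MeasurableSet.iUnion fun l => (MeasurableSet.const _).inter ((hsel p l).inter
      (hnum l (t := {n : ℕ | (n : ℕ∞) < N.extCap l}) trivial))

theorem integrable_algReward [IsFiniteMeasure μ] (T : ℕ) (A : J → ℕ → ℕ)
    {c : Packet J → ℕ → V → Ω → Choice V} (hc : ∀ p τ v, Measurable (c p τ v))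
    {r : ℕ → Packet J → Ω → ℕ} (hr : ∀ t p, Measurable (r t p)) :
    Integrable (fun ω => N.algReward T A (fun p τ v => c p τ v ω) (fun t p => r t p ω)) μ := by
  classical
  unfold algReward
  refine integrable_finsetSum _ fun p _ => ?_
  refine ((integrable_const (N.weight p.1)).indicator
    (measurableSet_location (N := N) T A hc hr (p.2.1 + N.deadline p.1 + 1) p
      (N.dst p.1))).congr (Filter.Eventually.of_forall fun ω => ?_)
  simp only [Set.indicator_apply, Set.mem_ofPred_eq]

theorem algReward_nonneg (T : ℕ) (A : J → ℕ → ℕ) (c : Packet J → ℕ → V → Choice V)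
    (r : ℕ → Packet J → ℕ) : 0 ≤ N.algReward T A c r :=
  Finset.sum_nonneg fun p _ => by
    split_ifs
    · exact N.weight_nonneg _
    · exact le_rfl

variable [IsProbabilityMeasure μ] {T : ℕ} {a : J → ℕ → Ω → ℕ}

/-- Choosing for each arrival pattern a schedule within `δ` of optimal and averaging gives a
feasible flow, whose value cannot exceed that of `f`; then `δ` tends to zero. -/
theorem integral_riValue_le {S : Finset (J → ℕ → ℕ)} (ha : ∀ j t, Measurable (a j t))
    (hS : ∀ᵐ ω ∂μ, truncate T (fun j t => a j t ω) ∈ S) {ε : ℝ} (hε : 0 < ε)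
    {f : J → V × V → ℕ → ℕ → ℝ} (hf : N.IsFNSOptimal T (fun j t => ∫ ω, (a j t ω : ℝ) ∂μ) ε f) :
    ∫ ω, N.riValue T (fun j t => a j t ω) ∂μ
      ≤ (1 + ε) * N.fnsObjective T (fun j t => ∫ ω, (a j t ω : ℝ) ∂μ) f := by
  set K : Ω → J → ℕ → ℕ := fun ω => truncate T fun j t => a j t ω with hKdef
  have hK : Measurable K := (measurable_truncate T).comp
    (measurable_pi_lambda _ fun j => measurable_pi_lambda _ fun t => ha j t)
  set p : (J → ℕ → ℕ) → ℝ := fun A => μ.real (K ⁻¹' {A}) with hp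
  have hp0 : ∀ A, 0 ≤ p A := fun A => measureReal_nonneg
  have hp1 : ∑ A ∈ S, p A = 1 := by
    have := integral_comp_of_finite_range hK hS fun _ => (1 : ℝ)
    simpa using this.symm
  have hlam : ∀ j, ∀ s ∈ Finset.Icc 1 T, ∫ ω, (a j s ω : ℝ) ∂μ = ∑ A ∈ S, p A * A j s := by
    intro j s hs
    rw [← integral_comp_of_finite_range hK hS fun A => (A j s : ℝ)]
    simp only [hKdef, truncate_apply _ j hs]
  have hri : ∫ ω, N.riValue T (fun j t => a j t ω) ∂μ = ∑ A ∈ S, p A * N.riValue T A := by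
    rw [← integral_comp_of_finite_range hK hS]
    exact integral_congr_ae (Filter.Eventually.of_forall fun ω =>
      riValue_congr fun j s hs => (truncate_apply (fun j t => a j t ω) j hs).symm)
  refine le_of_forall_pos_le_add fun δ hδ => ?_
  choose y hy hyδ using fun A => exists_feasible_of_lt_riValue N T A
    (x := N.riValue T A - δ) (by linarith)
  obtain ⟨g, hg, hgobj⟩ := exists_feasible_of_schedules (fun A _ => hp0 A) hp1.le hlam hε
    (y := y) fun A _ => hy A
  calc ∫ ω, N.riValue T (fun j t => a j t ω) ∂μ = ∑ A ∈ S, p A * N.riValue T A := hri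
    _ ≤ ∑ A ∈ S, (p A * N.riObjective T A (y A) + p A * δ) := Finset.sum_le_sum fun A _ => by
        rw [← mul_add]
        exact mul_le_mul_of_nonneg_left (by linarith [hyδ A]) (hp0 A)
    _ = (1 + ε) * N.fnsObjective T (fun j t => ∫ ω, (a j t ω : ℝ) ∂μ) g + δ := by
        rw [Finset.sum_add_distrib, ← Finset.sum_mul, hp1, one_mul, hgobj]
    _ ≤ _ := by
        have := mul_le_mul_of_nonneg_left (hf.2 g hg) (by linarith : (0 : ℝ) ≤ 1 + ε)
        linarith

theorem integrable_riValue {S : Finset (J → ℕ → ℕ)} (ha : ∀ j t, Measurable (a j t))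
    (hS : ∀ᵐ ω ∂μ, truncate T (fun j t => a j t ω) ∈ S) :
    Integrable (fun ω => N.riValue T (fun j t => a j t ω)) μ := by
  have hK : Measurable fun ω => truncate T fun j t => a j t ω := (measurable_truncate T).comp
    (measurable_pi_lambda _ fun j => measurable_pi_lambda _ fun t => ha j t)
  refine (integrable_comp_of_finite_range hK hS (F := fun A _ => N.riValue T A)
    fun A _ => integrable_const _).congr (Filter.Eventually.of_forall fun ω => ?_)
  exact riValue_congr fun j s hs => truncate_apply _ j hs

theorem integrable_algReward_arrivals {S : Finset (J → ℕ → ℕ)} (ha : ∀ j t, Measurable (a j t))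
    (hS : ∀ᵐ ω ∂μ, truncate T (fun j t => a j t ω) ∈ S)
    {c : Packet J → ℕ → V → Ω → Choice V} (hc : ∀ p τ v, Measurable (c p τ v))
    {r : ℕ → Packet J → Ω → ℕ} (hr : ∀ t p, Measurable (r t p)) :
    Integrable (fun ω => N.algReward T (fun j t => a j t ω) (fun p τ v => c p τ v ω)
      (fun t p => r t p ω)) μ := by
  have hK : Measurable fun ω => truncate T fun j t => a j t ω := (measurable_truncate T).comp
    (measurable_pi_lambda _ fun j => measurable_pi_lambda _ fun t => ha j t)
  refine (integrable_comp_of_finite_range hK hS (F := fun A ω => N.algReward T A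
    (fun p τ v => c p τ v ω) (fun t p => r t p ω)) fun A _ =>
    integrable_algReward T A hc hr).congr (Filter.Eventually.of_forall fun ω => ?_)
  exact N.algReward_congr _ _ (arrivedPackets_congr fun j s hs => truncate_apply _ j hs)

end Network

/-! ### The tail exponent and the capacity condition -/

theorem sq_div_two_le_log_sub {ε : ℝ} (hε : 0 < ε) :
    (ε / (1 + ε)) ^ 2 / 2 ≤ Real.log (1 + ε) - ε / (1 + ε) := by
  set x := ε / (1 + ε) with hx
  have h1 : 0 < 1 + ε := by linarith
  have hx0 : 0 ≤ x := by positivity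
  have hx1 : x < 1 := (div_lt_one h1).2 (by linarith)
  have hlog : Real.log (1 + ε) = -Real.log (1 - x) := by
    rw [← Real.log_inv]
    congr 1
    rw [hx]
    field_simp
    ring
  -- As `1 + ε = 1 / (1 - x)`, the claim keeps the first two terms `x + x² / 2` of the series of
  -- `-log (1 - x)`.
  have hs := sum_le_hasSum (Finset.range 2) (fun n _ => by positivity)
    (Real.hasSum_pow_div_log_of_abs_lt_one (x := x) (by rwa [abs_of_nonneg hx0]))
  simp only [Finset.sum_range_succ, Finset.sum_range_zero] at hs
  norm_num at hs
  rw [hlog]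
  linarith

/-- The left side is `exp (-(C / D) (log (1 + ε) - ε / (1 + ε)))`, and the bracket is at least `(ε /
(1 + ε))² / 2`; the condition on `C` is what makes this at most `ε / L`. -/
theorem exp_div_pow_le {D C : ℕ} {L ε u : ℝ} (hD : 1 ≤ D) (hε : 0 < ε) (hu : 0 ≤ u)
    (huD : (1 + u) ^ D = 1 + ε) (hL : 0 < L)
    (hC : 2 * (D : ℝ) * ((1 + ε) / ε) ^ 2 * Real.log (L / ε) ≤ C) :
    Real.exp (ε / D * (C / (1 + ε))) / (1 + u) ^ C ≤ ε / L := by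
  have hD0 : (0 : ℝ) < D := by exact_mod_cast hD
  have h1 : 0 < 1 + ε := by linarith
  have hu1 : 0 < 1 + u := by linarith
  have hlogu : Real.log (1 + u) = Real.log (1 + ε) / D := by
    rw [← huD, Real.log_pow]
    field_simp
  have hpow : (1 + u) ^ C = Real.exp (C * (Real.log (1 + ε) / D)) := by
    rw [← hlogu, mul_comm, ← Real.rpow_natCast, Real.rpow_def_of_pos hu1]
  have hlog : Real.log (L / ε) ≤ C * ((ε / (1 + ε)) ^ 2 / 2) / D := by
    rw [le_div_iff₀ hD0]
    have := mul_le_mul_of_nonneg_right hC (by positivity : 0 ≤ (ε / (1 + ε)) ^ 2 / 2)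
    refine le_trans (le_of_eq ?_) this
    field_simp
  rw [hpow, ← Real.exp_sub, ← Real.log_le_log_iff (Real.exp_pos _) (by positivity), Real.log_exp,
    ← inv_div L ε, Real.log_inv]
  have hkey : (C : ℝ) * ((ε / (1 + ε)) ^ 2 / 2) / D
      ≤ C * (Real.log (1 + ε) - ε / (1 + ε)) / D :=
    div_le_div_of_nonneg_right
      (mul_le_mul_of_nonneg_left (sq_div_two_le_log_sub hε) (Nat.cast_nonneg _)) hD0.le
  have : ε / D * (C / (1 + ε)) - C * (Real.log (1 + ε) / D)
      = -(C * (Real.log (1 + ε) - ε / (1 + ε)) / D) := by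
    field_simp
    ring
  rw [this]
  exact neg_le_neg (hlog.trans hkey)

/-! ### Expected loss on one link -/

namespace Network

variable {V J : Type*} [Fintype V] [DecidableEq V] [Fintype J] [DecidableEq J] (N : Network V J)

open Classical in
/-- The reward of the walks that reach their destinations, minus that of each packet for each
overloaded link that it meets. -/
noncomputable def walkReward (T : ℕ) (A : J → ℕ → ℕ) (c : Packet J → ℕ → V → Choice V) : ℝ :=
  ∑ p ∈ arrivedPackets T A, N.weight p.1 *
    ((if walk (c p) (N.src p.1) (N.deadline p.1 + 1) = some (N.dst p.1) then (1 : ℝ) else 0)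
      - ∑ τ ∈ Finset.range (N.deadline p.1 + 1), ∑ l : V × V with l.1 ≠ l.2,
        (if N.PicksInSlot c (p.2.1 + τ) l p ∧ N.cap l < N.load T A c (p.2.1 + τ) l
          then (1 : ℝ) else 0))

/-- The lower bound does not involve the processing order, which may therefore depend on the
arrivals and selections in any way. -/
theorem walkReward_le_algReward (T : ℕ) (A : J → ℕ → ℕ) (c : Packet J → ℕ → V → Choice V)
    (r : ℕ → Packet J → ℕ) : N.walkReward T A c ≤ N.algReward T A c r := by
  classical
  refine Finset.sum_le_sum fun p hp => ?_
  have h := mul_le_mul_of_nonneg_left (N.indicator_location_ge T A c r hp) (N.weight_nonneg p.1)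
  rw [mul_ite, mul_one, mul_zero] at h
  refine le_trans (le_of_eq ?_) h
  congr 2
  refine Finset.sum_congr rfl fun τ hτ => Finset.sum_congr rfl fun l _ => ?_
  have hτ' := Finset.mem_range.1 hτ
  have : N.PicksInSlot c (p.2.1 + τ) l p ↔ Picks (c p) (N.src p.1) τ l := by
    rw [PicksInSlot, Nat.add_sub_cancel_left]
    exact ⟨fun h => h.2.2, fun h => ⟨by omega, by omega, h⟩⟩
  simp only [this]

/-- A bound for the probability that a packet of type `j` arriving at `s` meets an overload on `l`
at age `τ`. -/
noncomputable def overloadBound (f : J → V × V → ℕ → ℕ → ℝ) (T : ℕ) (u : ℝ) (A : J → ℕ → ℕ) (j : J)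
    (s τ : ℕ) (l : V × V) : ℝ :=
  N.slotProb f l (s + τ) j s / (1 + u) ^ N.cap l *
    ((∏ j, ∏ s' ∈ Finset.Icc 1 T, (1 + u * N.slotProb f l (s + τ) j s') ^ A j s') /
      (1 + u * N.slotProb f l (s + τ) j s))

variable {N} {T : ℕ} {lam : J → ℕ → ℝ} {ε : ℝ} {f : J → V × V → ℕ → ℕ → ℝ}
variable {Ω : Type*} [MeasurableSpace Ω] {μ : Measure Ω} [IsProbabilityMeasure μ]
  {c : Packet J → ℕ → V → Ω → Choice V} {a : J → ℕ → Ω → ℕ}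

theorem measurableSet_overload (A : J → ℕ → ℕ) (hc : ∀ p τ v, Measurable (c p τ v))
    (p : Packet J) (t : ℕ) (l : V × V) :
    MeasurableSet {ω | N.PicksInSlot (fun p τ v => c p τ v ω) t l p ∧
        N.cap l < N.load T A (fun p τ v => c p τ v ω) t l} := by
  classical
  have hload : Measurable fun ω => N.load T A (fun p τ v => c p τ v ω) t l := by
    simp only [load, Finset.card_filter]
    exact Finset.measurable_sum _ fun q _ => Measurable.ite
      (measurableSet_picksInSlot (hc q) t l) measurable_const measurable_const
  exact (measurableSet_picksInSlot (hc p) t l).inter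
    (hload (t := {n : ℕ | N.cap l < n}) trivial)

theorem integrable_indicator_prop (P : Ω → Prop) [DecidablePred P] (hP : MeasurableSet {ω | P ω}) :
    Integrable (fun ω => if P ω then (1 : ℝ) else 0) μ := by
  refine ((integrable_const (1 : ℝ)).indicator hP).congr (Filter.Eventually.of_forall fun ω => ?_)
  simp only [Set.indicator_apply, Set.mem_ofPred_eq]

theorem integral_indicator_prop (P : Ω → Prop) [DecidablePred P] (hP : MeasurableSet {ω | P ω}) :
    ∫ ω, (if P ω then (1 : ℝ) else 0) ∂μ = μ.real {ω | P ω} := by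
  rw [← mul_one (μ.real {ω | P ω}), ← smul_eq_mul, ← integral_indicator_const _ hP]
  refine integral_congr_ae (Filter.Eventually.of_forall fun ω => ?_)
  simp only [Set.indicator_apply, Set.mem_ofPred_eq]

theorem measurable_walkReward (A : J → ℕ → ℕ) (hc : ∀ p τ v, Measurable (c p τ v)) :
    Measurable fun ω => N.walkReward T A (fun p τ v => c p τ v ω) := by
  classical
  refine Finset.measurable_sum _ fun p _ => ((Measurable.ite ?_ measurable_const
    measurable_const).sub (Finset.measurable_sum _ fun τ _ => Finset.measurable_sum _ fun l _ =>
    Measurable.ite (measurableSet_overload A hc p _ l) measurable_const measurable_const)).const_mul _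
  exact measurableSet_walk _ (fun τ' _ => hc p τ') _

theorem integrable_walkReward (A : J → ℕ → ℕ) (hc : ∀ p τ v, Measurable (c p τ v)) :
    Integrable (fun ω => N.walkReward T A (fun p τ v => c p τ v ω)) μ := by
  classical
  refine integrable_finsetSum _ fun p _ => ((integrable_indicator_prop _ ?_).sub
    (integrable_finsetSum _ fun τ _ => integrable_finsetSum _ fun l _ =>
      integrable_indicator_prop _ (measurableSet_overload A hc p _ l))).const_mul _
  exact measurableSet_walk _ (fun τ' _ => hc p τ') _

theorem IsForwardingRandomness.integral_walkReward_ge (hc : N.IsForwardingRandomness μ T a f c)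
    (hf : N.FNSFeasible T lam ε f) {u : ℝ} (hu : 0 ≤ u) (A : J → ℕ → ℕ) :
    ∑ j, ∑ s ∈ Finset.Icc 1 T, N.weight j * (A j s * N.flowValue f j s -
      ∑ τ ∈ Finset.range (N.deadline j + 1), ∑ l : V × V with l.1 ≠ l.2,
        A j s * N.overloadBound f T u A j s τ l)
    ≤ ∫ ω, N.walkReward T A (fun p τ v => c p τ v ω) ∂μ := by
  classical
  have hm := hc.measurable
  have hw : ∀ p : Packet J, MeasurableSet {ω | walk (fun τ v => c p τ v ω) (N.src p.1)
      (N.deadline p.1 + 1) = some (N.dst p.1)} :=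
    fun p => measurableSet_walk _ (fun τ' _ => hm p τ') _
  have hint : ∀ p τ l, Integrable (fun ω => if N.PicksInSlot (fun p τ v => c p τ v ω)
      (p.2.1 + τ) l p ∧ N.cap l < N.load T A (fun p τ v => c p τ v ω) (p.2.1 + τ) l
      then (1 : ℝ) else 0) μ :=
    fun p τ l => integrable_indicator_prop _ (measurableSet_overload A hm p _ l)
  have hint1 : ∀ p : Packet J, Integrable (fun ω => ∑ τ ∈ Finset.range (N.deadline p.1 + 1),
      ∑ l : V × V with l.1 ≠ l.2, if N.PicksInSlot (fun p τ v => c p τ v ω)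
      (p.2.1 + τ) l p ∧ N.cap l < N.load T A (fun p τ v => c p τ v ω) (p.2.1 + τ) l
      then (1 : ℝ) else 0) μ :=
    fun p => integrable_finsetSum _ fun τ _ => integrable_finsetSum _ fun l _ => hint p τ l
  unfold walkReward
  rw [integral_finsetSum]
  swap
  · exact fun p _ => ((integrable_indicator_prop _ (hw p)).sub (hint1 p)).const_mul _
  have hp : ∀ p ∈ arrivedPackets T A, N.weight p.1 * (N.flowValue f p.1 p.2.1 -
      ∑ τ ∈ Finset.range (N.deadline p.1 + 1), ∑ l : V × V with l.1 ≠ l.2,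
        N.overloadBound f T u A p.1 p.2.1 τ l) ≤
      ∫ ω, N.weight p.1 * ((if walk (fun τ v => c p τ v ω) (N.src p.1) (N.deadline p.1 + 1)
        = some (N.dst p.1) then (1 : ℝ) else 0) - ∑ τ ∈ Finset.range (N.deadline p.1 + 1),
        ∑ l : V × V with l.1 ≠ l.2, if N.PicksInSlot (fun p τ v => c p τ v ω)
        (p.2.1 + τ) l p ∧ N.cap l < N.load T A (fun p τ v => c p τ v ω) (p.2.1 + τ) l
        then (1 : ℝ) else 0) ∂μ := by
    intro p hp
    rw [integral_const_mul, integral_sub (integrable_indicator_prop _ (hw p)) (hint1 p),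
      integral_indicator_prop _ (hw p), integral_finsetSum _ fun τ _ => integrable_finsetSum _
        fun l _ => hint p τ l]
    refine mul_le_mul_of_nonneg_left (sub_le_sub (le_of_eq ?_) (Finset.sum_le_sum fun τ _ => ?_))
      (N.weight_nonneg _)
    · have hs := (mem_arrivedPackets.1 hp).1
      exact (hf.prob_walk_dst hs (hm p) (hc.packet p)
        fun τ hτ v l => hc.law p.1 p.2.1 hs p.2.2 τ hτ v l).symm
    · rw [integral_finsetSum _ fun l _ => hint p τ l]
      refine Finset.sum_le_sum fun l _ => ?_
      rw [integral_indicator_prop _ (measurableSet_overload A hm p _ l)]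
      exact hc.prob_overload_le hf hu A hp _ l
  refine le_trans (le_of_eq ?_) (Finset.sum_le_sum hp)
  rw [sum_arrivedPackets]
  refine Finset.sum_congr rfl fun j _ => Finset.sum_congr rfl fun s _ => ?_
  simp only [Finset.sum_const, Finset.card_range, nsmul_eq_mul, ← Finset.mul_sum]
  ring

/-- The packets lost on `l` among those of type `j` arriving at `s`. -/
theorem integral_mul_overloadBound_le (ha : ∀ j t, Measurable (a j t))
    (hindep : iIndepFun (fun j ω t => a j t ω) μ) {D : ℕ} (hD : 1 ≤ D)
    (hdec : ∀ j, ∀ t ∈ Finset.Icc 1 (T + N.dmax),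
      IsDecomposable (μ.map (fun ω (s : N.window T t) => a j s ω)) D)
    (hf : N.FNSFeasible T (fun j t => ∫ ω, (a j t ω : ℝ) ∂μ) ε f) (hε : 0 < ε)
    (hc : N.IsForwardingRandomness μ T a f c) {u : ℝ} (hu : 0 ≤ u) (huD : (1 + u) ^ D = 1 + ε)
    (j : J) {s τ : ℕ} (hs : s ∈ Finset.Icc 1 T) (hτ : τ ≤ N.deadline j) {l : V × V}
    (hl : l ∈ N.links) :
    ∫ ω, a j s ω * N.overloadBound f T u (fun j t => a j t ω) j s τ l ∂μ
      ≤ (∫ ω, (a j s ω : ℝ) ∂μ) * (N.pickProb f j s τ l * ((1 + ε) *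
        (Real.exp (ε / D * (N.cap l / (1 + ε))) / (1 + u) ^ N.cap l))) := by
  have hs' := Finset.mem_Icc.1 hs
  have hτd := hτ.trans (N.deadline_le_dmax j)
  set t := s + τ with ht
  have htmem : t ∈ Finset.Icc 1 (T + N.dmax) := Finset.mem_Icc.2 ⟨by omega, by omega⟩
  have hsW : s ∈ N.window T t := Finset.mem_Icc.2 ⟨by omega, by omega⟩
  set W := N.window T t with hW
  set q : J → ℕ → ℝ := N.slotProb f l t with hq
  have hqp : q j s = N.pickProb f j s τ l := N.slotProb_add f l s τ j
  have hq0 : ∀ j, ∀ s ∈ Finset.Icc 1 T, 0 ≤ q j s := fun j s hs => hf.slotProb_nonneg hs t l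
  have hq1 : ∀ j, ∀ s ∈ Finset.Icc 1 T, q j s ≤ 1 := by
    intro j s hs
    -- Selections are defined for every packet number, arrived or not, so number `0` can serve as a
    -- representative.
    rw [hq, ← hc.prob_picksInSlot hf (p := (j, s, 0)) hs t l]
    exact measureReal_le_one
  -- Only arrivals in the window can load slot `t`, so the dependency degree is needed for the
  -- window alone.
  have hout : ∀ j, ∀ s' ∈ Finset.Icc 1 T, s' ∉ W → q j s' = 0 := by
    intro j s' hs' hsW'
    have hd := N.deadline_le_dmax j
    simp only [hW, window, Finset.mem_Icc] at hs' hsW'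
    rw [hq, slotProb]
    split_ifs with h
    · rw [pickProb, if_neg fun h' => by omega]
    · rfl
  have hprod : ∀ ω, ∏ j, ∏ s' ∈ Finset.Icc 1 T, (1 + u * q j s') ^ a j s' ω
      = ∏ j, ∏ s' ∈ W, (1 + u * q j s') ^ a j s' ω := fun ω =>
    Finset.prod_congr rfl fun j _ => (Finset.prod_subset (window_subset t) fun s' hs' hsW' => by
      rw [hout j s' hs' hsW', mul_zero, add_zero, one_pow]).symm
  -- The mean load is at most the left side of the capacity constraint; inequality only, because `f`
  -- may be nonzero beyond a deadline, where `q` is zero.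
  have hcap : ∑ s ∈ W, ∑ j, (∫ ω, (a j s ω : ℝ) ∂μ) * q j s ≤ N.cap l / (1 + ε) := by
    refine le_trans (Finset.sum_le_sum fun s hs => Finset.sum_le_sum fun j _ => ?_)
      (hf.capacity l hl t htmem)
    refine mul_le_mul_of_nonneg_left ?_ (integral_nonneg fun ω => Nat.cast_nonneg _)
    have hle : l ∈ N.extLinks := Finset.mem_union_left _ hl
    have hs1 := window_subset t hs
    have hnn : 0 ≤ f j l (t - s) s := by
      refine hf.nonneg j l hle _ ?_ s hs1
      simp only [hW, window, Finset.mem_Icc] at hs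
      omega
    rw [hq, slotProb, pickProb]
    split_ifs <;> first | exact le_rfl | exact hnn
  have hmain := integral_mul_prod_prod_le ha hindep hD (fun j => hdec j t htmem) (q := q)
    (fun j s hs => hq0 j s (window_subset t hs)) (fun j s hs => hq1 j s (window_subset t hs))
    hu j hsW
  have h1ε : (0 : ℝ) < 1 + ε := by linarith
  have hu1 : 0 < 1 + u := by linarith
  have hm0 : 0 < 1 + u * q j s := by
    have := mul_nonneg hu (hq0 j s hs)
    linarith
  have hlam0 : 0 ≤ ∫ ω, (a j s ω : ℝ) ∂μ := integral_nonneg fun ω => Nat.cast_nonneg _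
  rw [huD, add_sub_cancel_left] at hmain
  have hexp : Real.exp (ε / D * ∑ s ∈ W, ∑ j, (∫ ω, (a j s ω : ℝ) ∂μ) * q j s)
      ≤ Real.exp (ε / D * (N.cap l / (1 + ε))) :=
    Real.exp_le_exp.2 (mul_le_mul_of_nonneg_left hcap (by positivity))
  have hpowD : (1 + u) ^ (D - 1) ≤ 1 + ε := by
    rw [← huD]
    exact pow_le_pow_right₀ (by linarith) (Nat.sub_le _ _)
  have hX : ∫ ω, a j s ω * ∏ j, ∏ s ∈ W, (1 + u * q j s) ^ a j s ω ∂μ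
      ≤ (1 + u * q j s) * (1 + ε) * (∫ ω, (a j s ω : ℝ) ∂μ) *
        Real.exp (ε / D * (N.cap l / (1 + ε))) := by
    refine hmain.trans (mul_le_mul ?_ hexp (Real.exp_pos _).le (by positivity))
    exact mul_le_mul_of_nonneg_right (mul_le_mul_of_nonneg_left hpowD hm0.le) hlam0
  have hrw : ∀ ω, (a j s ω : ℝ) * N.overloadBound f T u (fun j t => a j t ω) j s τ l
      = q j s / (1 + u) ^ N.cap l / (1 + u * q j s) *
        (a j s ω * ∏ j, ∏ s ∈ W, (1 + u * q j s) ^ a j s ω) := by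
    intro ω
    rw [← hprod ω, overloadBound]
    ring
  simp only [hrw]
  rw [integral_const_mul, ← hqp]
  have hcoef : 0 ≤ q j s / (1 + u) ^ N.cap l / (1 + u * q j s) :=
    div_nonneg (div_nonneg (hq0 j s hs) (pow_pos hu1 _).le) hm0.le
  refine (mul_le_mul_of_nonneg_left hX hcoef).trans (le_of_eq ?_)
  have hm0' := hm0.ne'
  -- The factor of the marked packet cancels against the one divided out in `overloadBound`.
  generalize 1 + u * q j s = m at hm0'
  field_simp

end Network

/-! ### Total loss and the reward of the algorithm -/

namespace Network

variable {V J : Type*} [Fintype V] [DecidableEq V] [Fintype J] [DecidableEq J] {N : Network V J}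
  {T : ℕ} {ε : ℝ} {f : J → V × V → ℕ → ℕ → ℝ}
  {Ω : Type*} [MeasurableSpace Ω] {μ : Measure Ω} [IsProbabilityMeasure μ]
  {c : Packet J → ℕ → V → Ω → Choice V} {a : J → ℕ → Ω → ℕ}

theorem exists_ae_le_mul (ha : ∀ j t, Measurable (a j t)) {D : ℕ}
    (hdec : ∀ j, ∀ t ∈ Finset.Icc 1 (T + N.dmax),
      IsDecomposable (μ.map (fun ω (s : N.window T t) => a j s ω)) D) :
    ∃ n : ℕ, ∀ᵐ ω ∂μ, ∀ j, ∀ s ∈ Finset.Icc 1 T, a j s ω ≤ n * D := by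
  have h : ∀ (j : J) (s : Finset.Icc 1 T), ∃ n : ℕ, ∀ᵐ ω ∂μ, a j s ω ≤ n * D := by
    rintro j ⟨s, hs⟩
    have hs' := Finset.mem_Icc.1 hs
    obtain ⟨n, hn⟩ := (hdec j s (Finset.mem_Icc.2 ⟨by omega, by omega⟩)).ae_le
    refine ⟨n, ?_⟩
    have hm : Measurable fun ω (s' : N.window T s) => a j s' ω :=
      measurable_pi_lambda (fun ω (s' : N.window T s) => a j s' ω) fun s' => ha j s'
    filter_upwards [ae_of_ae_map hm.aemeasurable hn] with ω hω
    exact hω ⟨s, Finset.mem_Icc.2 ⟨by omega, by omega⟩⟩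
  choose n hn using h
  refine ⟨∑ j, ∑ s, n j s, ?_⟩
  have hall : ∀ᵐ ω ∂μ, ∀ j, ∀ s : Finset.Icc 1 T, a j s ω ≤ n j s * D := by
    rw [ae_all_iff]
    exact fun j => ae_all_iff.2 (hn j)
  filter_upwards [hall] with ω hω j s hs
  refine (hω j ⟨s, hs⟩).trans (Nat.mul_le_mul_right D ?_)
  exact (Finset.single_le_sum (f := n j) (fun _ _ => Nat.zero_le _) (Finset.mem_univ _)).trans
    (Finset.single_le_sum (f := fun j => ∑ s, n j s) (fun _ _ => Nat.zero_le _)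
      (Finset.mem_univ j))

/-- The expected losses of the packets of type `j` arriving at `s`, over all ages and links. -/
theorem sum_integral_overloadBound_le (ha : ∀ j t, Measurable (a j t))
    (hindep : iIndepFun (fun j ω t => a j t ω) μ) {D : ℕ} (hD : 1 ≤ D)
    (hdec : ∀ j, ∀ t ∈ Finset.Icc 1 (T + N.dmax),
      IsDecomposable (μ.map (fun ω (s : N.window T t) => a j s ω)) D)
    (hε : 0 < ε)
    (hC : ∀ l ∈ N.links,
      2 * (D : ℝ) * ((1 + ε) / ε) ^ 2 * Real.log ((N.maxRouteLength : ℝ) / ε) ≤ (N.cap l : ℝ))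
    (hf : N.FNSFeasible T (fun j t => ∫ ω, (a j t ω : ℝ) ∂μ) ε f)
    (hc : N.IsForwardingRandomness μ T a f c) {u : ℝ} (hu : 0 ≤ u) (huD : (1 + u) ^ D = 1 + ε)
    (j : J) {s : ℕ} (hs : s ∈ Finset.Icc 1 T) :
    ∑ τ ∈ Finset.range (N.deadline j + 1), ∑ l : V × V with l.1 ≠ l.2,
        ∫ ω, a j s ω * N.overloadBound f T u (fun j t => a j t ω) j s τ l ∂μ
      ≤ (∫ ω, (a j s ω : ℝ) ∂μ) * ((1 + ε) * ε * N.flowValue f j s) := by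
  have h1ε : (0 : ℝ) < 1 + ε := by linarith
  have hu1 : 0 < 1 + u := by linarith
  have hlam0 : 0 ≤ ∫ ω, (a j s ω : ℝ) ∂μ := integral_nonneg fun ω => Nat.cast_nonneg _
  -- Pairs of distinct nodes that are not links carry no selection probability, so they contribute
  -- nothing on average.
  have hlinks : ∀ τ, ∑ l : V × V with l.1 ≠ l.2,
        ∫ ω, a j s ω * N.overloadBound f T u (fun j t => a j t ω) j s τ l ∂μ
      = ∑ l ∈ N.links,
        ∫ ω, a j s ω * N.overloadBound f T u (fun j t => a j t ω) j s τ l ∂μ := by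
    intro τ
    refine (Finset.sum_subset (fun l hl => ?_) fun l hl hl' => ?_).symm
    · rw [Finset.mem_filter]
      exact ⟨Finset.mem_univ _, fun h => N.irrefl l.1 (by rwa [show (l.1, l.1) = l from
        Prod.ext rfl h])⟩
    · have hext : l ∉ N.extLinks := by
        simp only [extLinks, Finset.mem_union, Finset.mem_diag, Finset.mem_univ, true_and]
        exact fun h => h.elim hl' (Finset.mem_filter.1 hl).2
      simp [overloadBound, slotProb_add, pickProb, hext]
  have hroute := hf.sum_links_le hs (hc.measurable (j, s, 0)) (hc.packet (j, s, 0))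
    fun τ hτ v l => hc.law j s hs 0 τ hτ v l
  have hη : ∀ τ ∈ Finset.range (N.deadline j + 1), ∀ l ∈ N.links,
      N.pickProb f j s τ l * (Real.exp (ε / D * (N.cap l / (1 + ε))) / (1 + u) ^ N.cap l)
        ≤ N.pickProb f j s τ l * (ε / N.maxRouteLength) := by
    intro τ hτ l hl
    -- If routes use no links, the capacity condition says nothing, but then the walks almost surely
    -- use no link either.
    rcases Nat.eq_zero_or_pos N.maxRouteLength with h0 | h0
    · rw [h0, Nat.cast_zero, zero_mul] at hroute
      have h1 : ∀ τ ∈ Finset.range (N.deadline j + 1), 0 ≤ ∑ l ∈ N.links, N.pickProb f j s τ l :=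
        fun τ _ => Finset.sum_nonneg fun l _ => hf.pickProb_nonneg hs τ l
      have h2 := (Finset.sum_eq_zero_iff_of_nonneg h1).1
        (le_antisymm hroute (Finset.sum_nonneg h1)) τ hτ
      have h3 := (Finset.sum_eq_zero_iff_of_nonneg fun l _ => hf.pickProb_nonneg hs τ l).1 h2 l hl
      rw [h3, zero_mul, zero_mul]
    · exact mul_le_mul_of_nonneg_left (exp_div_pow_le hD hε hu huD (by exact_mod_cast h0) (hC l hl))
        (hf.pickProb_nonneg hs τ l)
  have hscale : ε / N.maxRouteLength * (N.maxRouteLength * N.flowValue f j s)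
      ≤ ε * N.flowValue f j s := by
    have hF := hf.flowValue_nonneg hs (j := j)
    rcases Nat.eq_zero_or_pos N.maxRouteLength with h0 | h0
    · rw [h0, Nat.cast_zero, zero_mul, mul_zero]
      positivity
    · have : (N.maxRouteLength : ℝ) ≠ 0 := by exact_mod_cast h0.ne'
      exact le_of_eq (by field_simp)
  set lam := ∫ ω, (a j s ω : ℝ) ∂μ with hlam
  simp only [hlinks]
  calc ∑ τ ∈ Finset.range (N.deadline j + 1), ∑ l ∈ N.links,
        ∫ ω, a j s ω * N.overloadBound f T u (fun j t => a j t ω) j s τ l ∂μ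
      ≤ ∑ τ ∈ Finset.range (N.deadline j + 1), ∑ l ∈ N.links,
        lam * (1 + ε) * (ε / N.maxRouteLength) * N.pickProb f j s τ l := by
        refine Finset.sum_le_sum fun τ hτ => Finset.sum_le_sum fun l hl => ?_
        refine (integral_mul_overloadBound_le ha hindep hD hdec hf hε hc hu huD j hs
          (Nat.lt_succ_iff.1 (Finset.mem_range.1 hτ)) hl).trans ?_
        have := mul_le_mul_of_nonneg_left (hη τ hτ l hl) (mul_nonneg hlam0 h1ε.le)
        refine le_trans (le_of_eq ?_) (this.trans (le_of_eq ?_))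
        · ring
        · ring
    _ = lam * (1 + ε) * (ε / N.maxRouteLength) *
        ∑ τ ∈ Finset.range (N.deadline j + 1), ∑ l ∈ N.links, N.pickProb f j s τ l := by
        simp only [Finset.mul_sum]
    _ ≤ lam * (1 + ε) * (ε / N.maxRouteLength) * (N.maxRouteLength * N.flowValue f j s) :=
        mul_le_mul_of_nonneg_left hroute (by positivity)
    _ = lam * (1 + ε) * (ε / N.maxRouteLength * (N.maxRouteLength * N.flowValue f j s)) := by
        ring
    _ ≤ lam * (1 + ε) * (ε * N.flowValue f j s) :=
        mul_le_mul_of_nonneg_left hscale (by positivity)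
    _ = _ := by ring

theorem integral_algReward_ge {S : Finset (J → ℕ → ℕ)} (ha : ∀ j t, Measurable (a j t))
    (hS : ∀ᵐ ω ∂μ, truncate T (fun j t => a j t ω) ∈ S)
    (hindep : iIndepFun (fun j ω t => a j t ω) μ) {D : ℕ} (hD : 1 ≤ D)
    (hdec : ∀ j, ∀ t ∈ Finset.Icc 1 (T + N.dmax),
      IsDecomposable (μ.map (fun ω (s : N.window T t) => a j s ω)) D)
    (hε : 0 < ε)
    (hC : ∀ l ∈ N.links,
      2 * (D : ℝ) * ((1 + ε) / ε) ^ 2 * Real.log ((N.maxRouteLength : ℝ) / ε) ≤ (N.cap l : ℝ))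
    (hf : N.FNSFeasible T (fun j t => ∫ ω, (a j t ω : ℝ) ∂μ) ε f)
    (hc : N.IsForwardingRandomness μ T a f c)
    {r : ℕ → Packet J → Ω → ℕ} (hr : ∀ t p, Measurable (r t p)) :
    (1 - (1 + ε) * ε) * N.fnsObjective T (fun j t => ∫ ω, (a j t ω : ℝ) ∂μ) f
      ≤ ∫ ω, N.algReward T (fun j t => a j t ω) (fun p τ v => c p τ v ω)
        (fun t p => r t p ω) ∂μ := by
  have hD0 : (0 : ℝ) < D := by exact_mod_cast hD
  -- A full group of `D` packets then has total tilt `1 + ε`, the Chernoff choice for exceeding a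
  -- mean of `C / (1 + ε)` by the factor `1 + ε`.
  obtain ⟨u, hu, huD⟩ : ∃ u : ℝ, 0 ≤ u ∧ (1 + u) ^ D = 1 + ε := by
    refine ⟨(1 + ε) ^ (1 / (D : ℝ)) - 1, ?_, ?_⟩
    · exact sub_nonneg.2 (Real.one_le_rpow (by linarith) (by positivity))
    · rw [add_sub_cancel, ← Real.rpow_natCast, ← Real.rpow_mul (by linarith),
        one_div_mul_cancel hD0.ne', Real.rpow_one]
  set K : Ω → J → ℕ → ℕ := fun ω => truncate T fun j t => a j t ω with hKdef
  have hK : Measurable K := (measurable_truncate T).comp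
    (measurable_pi_lambda _ fun j => measurable_pi_lambda _ fun t => ha j t)
  set p : (J → ℕ → ℕ) → ℝ := fun A => μ.real (K ⁻¹' {A}) with hp
  have hp0 : ∀ A, 0 ≤ p A := fun A => measureReal_nonneg
  have hKa : ∀ ω j, ∀ s ∈ Finset.Icc 1 T, K ω j s = a j s ω := fun ω j s hs =>
    truncate_apply (fun j t => a j t ω) j hs
  set Y : Ω → Packet J × ℕ × V → Choice V := fun ω i => c i.1 i.2.1 i.2.2 ω with hY
  have hYm : Measurable Y := measurable_pi_lambda _ fun i => hc.measurable _ _ _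
  have hKY : IndepFun K Y μ := hc.indep_arrivals.comp (measurable_truncate T) measurable_id
  have hwalk : ∫ ω, N.walkReward T (K ω) (fun p τ v => c p τ v ω) ∂μ
      = ∑ A ∈ S, p A * ∫ ω, N.walkReward T A (fun p τ v => c p τ v ω) ∂μ :=
    integral_comp_of_finite_range_of_indep hK hYm hKY hS
      (G := fun A y => N.walkReward T A fun p τ v => y (p, τ, v))
      (fun A _ => measurable_walkReward A fun p τ v => measurable_pi_apply (p, τ, v))
      fun A _ => integrable_walkReward A hc.measurable
  have hlam : ∀ j, ∀ s ∈ Finset.Icc 1 T, ∑ A ∈ S, p A * (A j s : ℝ) = ∫ ω, (a j s ω : ℝ) ∂μ := by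
    intro j s hs
    rw [← integral_comp_of_finite_range hK hS fun A => (A j s : ℝ)]
    simp only [hKa _ j s hs]
  have hloss : ∀ j, ∀ s ∈ Finset.Icc 1 T, ∀ τ l,
      ∑ A ∈ S, p A * ((A j s : ℝ) * N.overloadBound f T u A j s τ l)
        = ∫ ω, a j s ω * N.overloadBound f T u (fun j t => a j t ω) j s τ l ∂μ := by
    intro j s hs τ l
    rw [← integral_comp_of_finite_range hK hS fun A =>
      (A j s : ℝ) * N.overloadBound f T u A j s τ l]
    refine integral_congr_ae (Filter.Eventually.of_forall fun ω => ?_)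
    simp only [hKa ω j s hs, overloadBound]
    congr 3
    exact Finset.prod_congr rfl fun j _ => Finset.prod_congr rfl fun s' hs' => by
      rw [hKa ω j s' hs']
  calc (1 - (1 + ε) * ε) * N.fnsObjective T (fun j t => ∫ ω, (a j t ω : ℝ) ∂μ) f
      = ∑ j, ∑ s ∈ Finset.Icc 1 T, N.weight j * ((∫ ω, (a j s ω : ℝ) ∂μ) * N.flowValue f j s -
          (∫ ω, (a j s ω : ℝ) ∂μ) * ((1 + ε) * ε * N.flowValue f j s)) := by
        rw [fnsObjective, Finset.sum_comm, Finset.mul_sum]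
        refine Finset.sum_congr rfl fun j _ => ?_
        rw [Finset.mul_sum]
        refine Finset.sum_congr rfl fun s _ => ?_
        rw [← flowValue]
        ring
    _ ≤ ∑ j, ∑ s ∈ Finset.Icc 1 T, N.weight j * ((∫ ω, (a j s ω : ℝ) ∂μ) * N.flowValue f j s -
          ∑ τ ∈ Finset.range (N.deadline j + 1), ∑ l : V × V with l.1 ≠ l.2,
            ∫ ω, a j s ω * N.overloadBound f T u (fun j t => a j t ω) j s τ l ∂μ) := by
        refine Finset.sum_le_sum fun j _ => Finset.sum_le_sum fun s hs => ?_
        exact mul_le_mul_of_nonneg_left (sub_le_sub_left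
          (sum_integral_overloadBound_le ha hindep hD hdec hε hC hf hc hu huD j hs) _)
          (N.weight_nonneg j)
    _ = ∑ A ∈ S, p A * ∑ j, ∑ s ∈ Finset.Icc 1 T, N.weight j * (A j s * N.flowValue f j s -
          ∑ τ ∈ Finset.range (N.deadline j + 1), ∑ l : V × V with l.1 ≠ l.2,
            A j s * N.overloadBound f T u A j s τ l) := by
        simp only [Finset.mul_sum (s := Finset.univ (α := J)),
          Finset.mul_sum (s := Finset.Icc 1 T)]
        symm
        rw [Finset.sum_comm]
        refine Finset.sum_congr rfl fun j _ => ?_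
        rw [Finset.sum_comm]
        refine Finset.sum_congr rfl fun s hs => ?_
        symm
        simp only [← hlam j s hs, ← hloss j s hs]
        have hcomm : ∀ g : ℕ → V × V → (J → ℕ → ℕ) → ℝ,
            ∑ τ ∈ Finset.range (N.deadline j + 1), ∑ l : V × V with l.1 ≠ l.2, ∑ A ∈ S, g τ l A
            = ∑ A ∈ S, ∑ τ ∈ Finset.range (N.deadline j + 1), ∑ l : V × V with l.1 ≠ l.2,
              g τ l A :=
          fun g => (Finset.sum_congr rfl fun τ _ => Finset.sum_comm).trans Finset.sum_comm
        rw [hcomm, Finset.sum_mul, ← Finset.sum_sub_distrib, Finset.mul_sum]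
        refine Finset.sum_congr rfl fun A _ => ?_
        simp only [← Finset.mul_sum]
        ring
    _ ≤ ∑ A ∈ S, p A * ∫ ω, N.walkReward T A (fun p τ v => c p τ v ω) ∂μ :=
        Finset.sum_le_sum fun A _ =>
          mul_le_mul_of_nonneg_left (hc.integral_walkReward_ge hf hu A) (hp0 A)
    _ = ∫ ω, N.walkReward T (K ω) (fun p τ v => c p τ v ω) ∂μ := hwalk.symm
    _ ≤ _ := by
        refine integral_mono (integrable_comp_of_finite_range hK hS (F := fun A ω =>
          N.walkReward T A (fun p τ v => c p τ v ω)) fun A _ =>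
            integrable_walkReward A hc.measurable)
          (integrable_algReward_arrivals ha hS hc.measurable hr) fun ω => ?_
        refine (N.walkReward_le_algReward T (K ω) _ fun t p => r t p ω).trans (le_of_eq ?_)
        exact N.algReward_congr _ _ (arrivedPackets_congr fun j s hs => hKa ω j s hs)

end Network

/-! ### The approximation guarantee -/

theorem theorem4 {V J : Type*} [Fintype V] [DecidableEq V] [Fintype J] [DecidableEq J]
    (N : Network V J) (T D : ℕ)
    {Ω : Type*} [MeasurableSpace Ω] (μ : Measure Ω) [IsProbabilityMeasure μ]
    -- arrivals: independent across types, windowed traffic of dependency degree at most `D`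
    (a : J → ℕ → Ω → ℕ) (ha : ∀ j t, Measurable (a j t))
    (hindep : iIndepFun (fun j ω t => a j t ω) μ)
    (hD : ∀ j, ∀ t ∈ Finset.Icc 1 (T + N.dmax),
      dependencyDegree (μ.map (fun ω (s : N.window T t) => a j s ω)) ≤ D)
    (ε : ℝ) (hε0 : 0 < ε) (hε : ε < 1 / 2)
    (hC : ∀ l ∈ N.links,
      2 * (D : ℝ) * ((1 + ε) / ε) ^ 2 * Real.log ((N.maxRouteLength : ℝ) / ε) ≤ (N.cap l : ℝ))
    -- any optimal solution of the linear program for the arrival rates `E[a j t]`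
    (f : J → V × V → ℕ → ℕ → ℝ)
    (hf : N.IsFNSOptimal T (fun j t => ∫ ω, (a j t ω : ℝ) ∂μ) ε f)
    -- the random link selections, and any (possibly random) processing order in each slot
    (c : Packet J → ℕ → V → Ω → Choice V) (hc : N.IsForwardingRandomness μ T a f c)
    (r : ℕ → Packet J → Ω → ℕ) (hr : ∀ t p, Measurable (r t p))
    (hr_inj : ∀ t ω, Function.Injective (fun p => r t p ω)) :
    IsApproximation μ (1 - 2 * ε)
      (fun ω => N.algReward T (fun j t => a j t ω) (fun p τ v => c p τ v ω)
        (fun t p => r t p ω))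
      (fun ω => N.riValue T (fun j t => a j t ω)) := by
  have hdec : ∀ j, ∀ t ∈ Finset.Icc 1 (T + N.dmax),
      IsDecomposable (μ.map (fun ω (s : N.window T t) => a j s ω)) D :=
    fun j t ht => isDecomposable_of_dependencyDegree_le (hD j t ht)
  obtain ⟨n, hn⟩ := Network.exists_ae_le_mul ha hdec
  obtain ⟨S, hS⟩ := exists_finset_truncate_mem (J := J) T (n * D)
  have hS' : ∀ᵐ ω ∂μ, truncate T (fun j t => a j t ω) ∈ S := hn.mono fun ω h => hS _ h
  refine ⟨Network.integrable_algReward_arrivals ha hS' hc.measurable hr,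
    Network.integrable_riValue ha hS', ?_⟩
  have hri := Network.integral_riValue_le ha hS' hε0 hf
  have h2ε : 0 ≤ 1 - 2 * ε := by linarith
  refine (mul_le_mul_of_nonneg_left hri h2ε).trans ?_
  -- For `D = 0` no tilt `u` exists, but almost surely no packet arrives and the objective is zero.
  rcases Nat.eq_zero_or_pos D with rfl | hD1
  · have hlam : ∀ j, ∀ s ∈ Finset.Icc 1 T, ∫ ω, (a j s ω : ℝ) ∂μ = 0 := by
      intro j s hs
      refine integral_eq_zero_of_ae (hn.mono fun ω h => ?_)
      simpa using h j s hs
    have hobj : N.fnsObjective T (fun j t => ∫ ω, (a j t ω : ℝ) ∂μ) f = 0 :=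
      Finset.sum_eq_zero fun s hs => Finset.sum_eq_zero fun j _ => by
        simp only [hlam j s hs, mul_zero, zero_mul]
    rw [hobj, mul_zero, mul_zero]
    exact integral_nonneg fun ω => Network.algReward_nonneg _ _ _ _
  · refine le_trans ?_ (Network.integral_algReward_ge ha hS' hindep hD1 hdec hε0 hC hf.1 hc hr)
    have hobj : 0 ≤ N.fnsObjective T (fun j t => ∫ ω, (a j t ω : ℝ) ∂μ) f :=
      Finset.sum_nonneg fun s hs => Finset.sum_nonneg fun j _ => mul_nonneg
        (mul_nonneg (N.weight_nonneg j) (integral_nonneg fun ω => Nat.cast_nonneg _))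
        (hf.1.flowValue_nonneg hs)
    -- `(1 - (1 + ε) ε) - (1 - 2ε)(1 + ε) = ε²`.
    have := mul_nonneg (sq_nonneg ε) hobj
    linarith
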